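/- A \emph{difference ring} is a commutative ring $R$ equipped with an automorphism $\tau$. A \emph{difference module} over $R$ is an $R$-module $M$ equipped with a bijective additive map $\tau$ satisfying $\tau(rm)=\tau(r)\tau(m)$. A difference submodule of $M$ is a submodule $N$ with $\tau(N)=N$. A difference ring $R$ is \emph{simple} if $R\neq 0$ and the only ideals $I$ of $R$ with $\tau(I)=I$ are $0$ and $R$. Write $C_R=\{r\in R:\tau(r)=r\}$; this is a field when $R$ is simple. A difference ring is \emph{ind-noetherian} if it is the directed union of difference subrings (subrings $A$ with $\tau(A)=A$) whose underlying rings are noetherian. Let $R$ be a simple difference ring and $M$ a difference module over $R$ whose underlying $R$-module is finite projective, with dual $M^\vee$. A \emph{Picard--Vessiot extension} of $R$ for $M$ is a difference ring $S$ with a ring homomorphism $R\to S$ commuting with $\tau$, such that: (a) $S$ is faithfully flat as an $R$-module; (b) $S$ is a simple difference ring; (c) $C_S=C_R$; (d) the difference module $M\otimes_R S$, with $\tau(m\otimes s)=\tau(m)\otimes\tau(s)$, has a finite $S$-basis fixed by $\tau$; (e) for all generators $\mathbf v_1,\dots,\mathbf v_m$ of $M$ and $\mathbf w_1,\dots,\mathbf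 w_m$ of $M^\vee$, every $\tau$-fixed basis $\mathbf e_1,\dots,\mathbf e_n$ of $M\otimes_R S$ with dual basis $\mathbf e_1^*,\dots,\mathbf e_n^*$ of $M^\vee\otimes_R S$, and all $A_{ij},B_{ij}\in S$ with $\mathbf e_j=\sum_i A_{ij}\mathbf v_i$ and $\mathbf e_j^*=\sum_i B_{ij}\mathbf w_i$, the $R$-algebra $S$ is generated by the $A_{ij}$ and $B_{ij}$. \textbf{Proposition.} Let $R$ be a simple ind-noetherian difference ring such that the field $C_R$ is algebraically closed, and let $M$ be a difference module over $R$ whose underlying $R$-module is finite projective. Then there exists a Picard--Vessiot extension $S$ of $R$ for $M$; it is ind-noetherian; and it is unique, in the sense that for every Picard--Vessiot extension $S'$ of $R$ for $M$ (not assumed ind-noetherian) there is an isomorphism $S\to S'$ of $R$-algebras commuting with $\tau$. -/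

import Mathlib

open scoped TensorProduct

universe u v w

/-- A difference ring: a commutative ring with a distinguished automorphism `τ`. -/
class DifferenceRing (R : Type*) [CommRing R] where
  /-- The automorphism. -/
  tau : R ≃+* R

/-- A difference module over a difference ring: a module with a bijective additive map `τ` such
that `τ (r • m) = τ r • τ m`. -/
class DifferenceModule (R M : Type*) [CommRing R] [DifferenceRing R] [AddCommGroup M]
    [Module R M] where
  /-- The bijective semilinear action. -/
  tau : M ≃+ M
  tau_smul : ∀ (r : R) (m : M), tau (r • m) = DifferenceRing.tau r • tau m

/-- A difference ring is a difference module over itself. -/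
instance DifferenceModule.self (R : Type*) [CommRing R] [DifferenceRing R] :
    DifferenceModule R R where
  tau := (DifferenceRing.tau : R ≃+* R).toAddEquiv
  tau_smul r m := map_mul (DifferenceRing.tau : R ≃+* R) r m

/-- A submodule `N` is a difference submodule if `τ` restricts to a bijection of `N`. -/
def IsDifferenceSubmodule (R : Type*) {M : Type*} [CommRing R] [DifferenceRing R]
    [AddCommGroup M] [Module R M] [DifferenceModule R M] (N : Submodule R M) : Prop :=
  ∀ m : M, DifferenceModule.tau R m ∈ N ↔ m ∈ N

/-- A difference module is simple if it is nonzero and its only difference submodules are `0` and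
the whole module. -/
structure IsSimpleDifferenceModule (R M : Type*) [CommRing R] [DifferenceRing R]
    [AddCommGroup M] [Module R M] [DifferenceModule R M] : Prop where
  nontrivial : Nontrivial M
  eq_bot_or_eq_top : ∀ N : Submodule R M, IsDifferenceSubmodule R N → N = ⊥ ∨ N = ⊤

/-- A difference ring is simple if it is simple as a difference module over itself. -/
def IsSimpleDifferenceRing (R : Type*) [CommRing R] [DifferenceRing R] : Prop :=
  IsSimpleDifferenceModule R R

/-- The ring of constants: the subring of elements fixed by `τ`. -/
def differenceConstants (R : Type*) [CommRing R] [DifferenceRing R] : Subring R where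
  carrier := {r | DifferenceRing.tau r = r}
  mul_mem' {a b} ha hb := by
    simp only [Set.mem_ofPred_eq] at ha hb ⊢
    rw [map_mul, ha, hb]
  one_mem' := map_one (DifferenceRing.tau : R ≃+* R)
  add_mem' {a b} ha hb := by
    simp only [Set.mem_ofPred_eq] at ha hb ⊢
    rw [map_add, ha, hb]
  zero_mem' := map_zero (DifferenceRing.tau : R ≃+* R)
  neg_mem' {a} ha := by
    simp only [Set.mem_ofPred_eq] at ha ⊢
    rw [map_neg, ha]

/-- The constants form an algebraically closed field. -/
def HasAlgClosedConstants (R : Type*) [CommRing R] [DifferenceRing R] : Prop :=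
  ∃ h : IsField (differenceConstants R),
    letI : Field (differenceConstants R) := h.toField
    IsAlgClosed (differenceConstants R)

/-- A subring is a difference subring if `τ` restricts to an automorphism of it. -/
def IsDifferenceSubring {R : Type*} [CommRing R] [DifferenceRing R] (A : Subring R) : Prop :=
  ∀ r : R, DifferenceRing.tau r ∈ A ↔ r ∈ A

/-- A difference ring is ind-noetherian if it is the direct limit, that is, the directed union, of
difference subrings whose underlying rings are noetherian. -/
def IsIndNoetherian (R : Type*) [CommRing R] [DifferenceRing R] : Prop :=
  ∃ F : Set (Subring R),
    F.Nonempty ∧ DirectedOn (· ≤ ·) F ∧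
    (∀ A ∈ F, IsDifferenceSubring A ∧ IsNoetherianRing A) ∧
    ∀ r : R, ∃ A ∈ F, r ∈ A

/-- `S` is a difference ring over `R`: the structure map `R → S` commutes with `τ`. -/
class DifferenceAlgebra (R S : Type*) [CommRing R] [DifferenceRing R] [CommRing S]
    [DifferenceRing S] [Algebra R S] : Prop where
  algebraMap_tau : ∀ r : R,
    algebraMap R S (DifferenceRing.tau r) = DifferenceRing.tau (algebraMap R S r)

section BaseChange

variable (R S M : Type*) [CommRing R] [DifferenceRing R] [CommRing S] [DifferenceRing S]
  [Algebra R S] [DifferenceAlgebra R S] [AddCommGroup M] [Module R M] [DifferenceModule R M]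

theorem DifferenceAlgebra.tau_smul (r : R) (s : S) :
    (DifferenceRing.tau (r • s) : S) = DifferenceRing.tau r • DifferenceRing.tau s := by
  rw [Algebra.smul_def, map_mul, Algebra.smul_def, DifferenceAlgebra.algebraMap_tau]

theorem DifferenceAlgebra.tau_symm_smul (r : R) (s : S) :
    (DifferenceRing.tau.symm (r • s) : S) =
      DifferenceRing.tau.symm r • DifferenceRing.tau.symm s := by
  rw [RingEquiv.symm_apply_eq, DifferenceAlgebra.tau_smul, RingEquiv.apply_symm_apply,
    RingEquiv.apply_symm_apply]

theorem DifferenceModule.tau_symm_smul (r : R) (m : M) :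
    (DifferenceModule.tau R).symm (r • m) =
      DifferenceRing.tau.symm r • (DifferenceModule.tau R).symm m := by
  rw [AddEquiv.symm_apply_eq, DifferenceModule.tau_smul, RingEquiv.apply_symm_apply,
    AddEquiv.apply_symm_apply]

/-- The additive map `s ⊗ m ↦ τ s ⊗ τ m`. -/
def DifferenceModule.baseChangeHom : S ⊗[R] M →+ S ⊗[R] M :=
  TensorProduct.liftAddHom
    { toFun := fun s =>
        { toFun := fun m => DifferenceRing.tau s ⊗ₜ[R] DifferenceModule.tau R m
          map_zero' := by simp
          map_add' := fun m m' => by simp [TensorProduct.tmul_add] }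
      map_zero' := by ext; simp
      map_add' := fun s s' => by ext; simp [TensorProduct.add_tmul] }
    (fun r s m => by
      simp [DifferenceAlgebra.tau_smul, DifferenceModule.tau_smul, TensorProduct.smul_tmul])

/-- The additive map `s ⊗ m ↦ τ⁻¹ s ⊗ τ⁻¹ m`. -/
def DifferenceModule.baseChangeInv : S ⊗[R] M →+ S ⊗[R] M :=
  TensorProduct.liftAddHom
    { toFun := fun s =>
        { toFun := fun m => DifferenceRing.tau.symm s ⊗ₜ[R] (DifferenceModule.tau R).symm m
          map_zero' := by simp
          map_add' := fun m m' => by simp [TensorProduct.tmul_add] }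
      map_zero' := by ext; simp
      map_add' := fun s s' => by ext; simp [TensorProduct.add_tmul] }
    (fun r s m => by
      simp [DifferenceAlgebra.tau_symm_smul, DifferenceModule.tau_symm_smul,
        TensorProduct.smul_tmul])

/-- The base extension `S ⊗ M` of a difference module, with `τ (s ⊗ m) = τ s ⊗ τ m`. -/
instance DifferenceModule.baseChange : DifferenceModule S (S ⊗[R] M) where
  tau :=
    { toFun := DifferenceModule.baseChangeHom R S M
      invFun := DifferenceModule.baseChangeInv R S M
      left_inv := fun x => by
        induction x with
        | zero => simp
        | tmul s m => simp [DifferenceModule.baseChangeHom, DifferenceModule.baseChangeInv]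
        | add x y hx hy => rw [map_add, map_add, hx, hy]
      right_inv := fun x => by
        induction x with
        | zero => simp
        | tmul s m => simp [DifferenceModule.baseChangeHom, DifferenceModule.baseChangeInv]
        | add x y hx hy => rw [map_add, map_add, hx, hy]
      map_add' := map_add _ }
  tau_smul s x := by
    change DifferenceModule.baseChangeHom R S M (s • x) =
      DifferenceRing.tau s • DifferenceModule.baseChangeHom R S M x
    induction x with
    | zero => simp
    | tmul t m => simp [DifferenceModule.baseChangeHom, TensorProduct.smul_tmul']
    | add x y hx hy => rw [smul_add, map_add, map_add, hx, hy, smul_add]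

theorem DifferenceModule.baseChange_tau_tmul (s : S) (m : M) :
    DifferenceModule.tau S (s ⊗ₜ[R] m) =
      DifferenceRing.tau s ⊗ₜ[R] DifferenceModule.tau R m := rfl

end BaseChange

/-- A basis of a difference module is `τ`-fixed if each of its members is. -/
def IsFixedBasis {S N : Type*} [CommRing S] [DifferenceRing S] [AddCommGroup N] [Module S N]
    [DifferenceModule S N] {n : ℕ} (e : Module.Basis (Fin n) S N) : Prop :=
  ∀ j, DifferenceModule.tau S (e j) = e j

/-- `S` is a Picard-Vessiot extension of `R` for the difference module `M`.

In the last condition, `e_j = ∑ i, A i j • v_i` in `S ⊗ M`, and the dual basis satisfies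
`e*_j = ∑ i, B i j • w_i` in `S ⊗ Mᵛ = (S ⊗ M)ᵛ`, the latter being tested on the elements `1 ⊗ m`,
which span `S ⊗ M`. As `v` and `w` need not be linearly independent, the coefficients are not
determined by `v`, `w` and `e`; the condition is imposed for every choice. -/
structure IsPicardVessiot (R M S : Type*) [CommRing R] [DifferenceRing R] [AddCommGroup M]
    [Module R M] [DifferenceModule R M] [CommRing S] [DifferenceRing S] [Algebra R S]
    [DifferenceAlgebra R S] : Prop where
  faithfullyFlat : Module.FaithfullyFlat R S
  simple : IsSimpleDifferenceRing S
  constants_eq : differenceConstants S = (differenceConstants R).map (algebraMap R S)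
  trivial : ∃ (n : ℕ) (e : Module.Basis (Fin n) S (S ⊗[R] M)), IsFixedBasis e
  generated : ∀ (m n : ℕ) (v : Fin m → M) (w : Fin m → Module.Dual R M)
    (e : Module.Basis (Fin n) S (S ⊗[R] M)) (A B : Fin m → Fin n → S),
    Submodule.span R (Set.range v) = ⊤ →
    Submodule.span R (Set.range w) = ⊤ →
    IsFixedBasis e →
    (∀ j, e j = ∑ i, A i j ⊗ₜ[R] v i) →
    (∀ j (x : M), e.coord j (1 ⊗ₜ[R] x) = ∑ i, B i j * algebraMap R S (w i x)) →
    Algebra.adjoin R ({s | ∃ i j, s = A i j} ∪ {s | ∃ i j, s = B i j}) = ⊤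

/-!
A Picard-Vessiot extension is a simple quotient of the universal algebra over which `M` becomes
trivial; the points to be checked are faithful flatness and the absence of new constants.

*Projectivity.* Over a simple difference ring `R`, a finitely generated module with a semilinear
bijection is projective (`IsSimpleDifferenceRing.projective`). The scalars `c` such that
multiplication by `c` factors through a finite free module form a `τ`-stable ideal, so it is enough
that one of them is nonzero. As `R` is reduced, this is a variant of generic freeness: choose a
nonzero `f` and a shortest list of vectors whose span contains `f M`; then `f ^ 2` will do.

*Faithful flatness.* The relevant difference algebras are *locally finite*, that is, unions of
finitely generated `τ`-stable `R`-submodules. These submodules and their quotients by one another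
are projective, so they are pure in the whole algebra. Faithful flatness follows.

*Constants.* Let `S` be simple, locally finite and of finite type over `R`, and suppose that a
constant `t` of `S` does not come from `C_R`. Then `t - a` is invertible for all `a ∈ C_R`, and
`R[t] ⊆ S` is a polynomial ring because `C_R` is algebraically closed. By purity it stays one in a
fibre of `S` over a maximal ideal of `R` with residue field `k`. The image of the spectrum of this
fibre in the affine line over `k` contains a nonempty open set, hence meets the infinite set `C_R`,
which contradicts the invertibility of `t - a` (`differenceConstants_eq_map`).

*Existence.* A dual basis of `M` presents `M` by matrices `P`, `Φ`, `Ψ` (`DifferenceSystem`), and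
trivializations of `M` become pairs of matrices `A`, `B` with `B A = 1`, `A B = P` and
`A = Φ τ(A)`. The universal algebra is generated by the entries of `A` and `B`; it is nonzero for
`n` the rank of `M` at some maximal ideal. A simple quotient of it is a Picard-Vessiot extension.
Two solutions over the same ring differ by a matrix of constants, so the algebra generated by a
solution does not depend on the solution if no new constants are present.

*Uniqueness.* Two Picard-Vessiot extensions embed into a simple quotient of their tensor product.
This quotient has no new constants, so the two images, both generated by a solution, coincide.

The hypothesis that `R` is ind-noetherian serves only to show that the extension is ind-noetherian:
a solution can be adjoined to the noetherian difference subrings of `R` containing the entries of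
`Φ` and `Ψ`.
-/

/-! ### Finitely generated difference modules are projective -/

namespace IsSimpleDifferenceRing

variable {R : Type*} [CommRing R] [DifferenceRing R]

theorem ideal_eq_bot_or_eq_top (hR : IsSimpleDifferenceRing R) (I : Ideal R)
    (hI : ∀ r : R, DifferenceRing.tau r ∈ I ↔ r ∈ I) : I = ⊥ ∨ I = ⊤ :=
  hR.eq_bot_or_eq_top I hI

theorem isReduced (hR : IsSimpleDifferenceRing R) : IsReduced R := by
  have := hR.nontrivial
  rw [← nilradical_eq_bot_iff]
  refine (hR.ideal_eq_bot_or_eq_top (nilradical R) fun r => ?_).resolve_right fun h => ?_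
  · simp only [mem_nilradical]
    exact IsNilpotent.map_iff (DifferenceRing.tau : R ≃+* R).injective
  · have h1 : (1 : R) ∈ nilradical R := h ▸ Submodule.mem_top
    exact not_isNilpotent_one (mem_nilradical.mp h1)

end IsSimpleDifferenceRing

section FiniteProjective

variable {R : Type*} [CommRing R] {M : Type*} [AddCommGroup M] [Module R M]

/-- Multiplication by `c` on `M` factors through a finite free module; the factorization is recorded
as `c • x = ∑ i, φ i x • y i`. -/
def FactorsThroughFinFree (M : Type*) [AddCommGroup M] [Module R M] (c : R) : Prop :=
  ∃ (n : ℕ) (φ : Fin n → Module.Dual R M) (y : Fin n → M), ∀ x, c • x = ∑ i, φ i x • y i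

/-- The ideal of those `c` for which multiplication by `c` factors through a finite free module. -/
def finFreeIdeal (R M : Type*) [CommRing R] [AddCommGroup M] [Module R M] : Ideal R where
  carrier := {c | FactorsThroughFinFree M c}
  zero_mem' := ⟨0, Fin.elim0, Fin.elim0, fun x => by simp⟩
  add_mem' := by
    rintro a b ⟨n, φ, y, h⟩ ⟨n', φ', y', h'⟩
    refine ⟨n + n', Fin.append φ φ', Fin.append y y', fun x => ?_⟩
    simp [Fin.sum_univ_add, add_smul, h, h']
  smul_mem' := by
    rintro c a ⟨n, φ, y, h⟩
    refine ⟨n, fun i => c • φ i, y, fun x => ?_⟩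
    simp [mul_smul, h, Finset.smul_sum]

theorem projective_of_one_mem_finFreeIdeal (h : (1 : R) ∈ finFreeIdeal R M) :
    Module.Projective R M := by
  obtain ⟨n, φ, y, h⟩ := h
  refine Module.Projective.of_split (LinearMap.pi φ) (Fintype.linearCombination R y) ?_
  ext x
  simpa [Fintype.linearCombination_apply] using (h x).symm

/-- The conjugate of a linear form by a semilinear bijection. -/
def conjDual (σ : R ≃+* R) (t : M ≃+ M) (h : ∀ (r : R) (x : M), t (r • x) = σ r • t x)
    (φ : Module.Dual R M) : Module.Dual R M where
  toFun x := σ (φ (t.symm x))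
  map_add' x y := by simp
  map_smul' r x := by
    have : t.symm (r • x) = σ.symm r • t.symm x := by
      rw [AddEquiv.symm_apply_eq, h]; simp
    simp [this]

theorem map_mem_finFreeIdeal (σ : R ≃+* R) (t : M ≃+ M)
    (h : ∀ (r : R) (x : M), t (r • x) = σ r • t x) {c : R} (hc : c ∈ finFreeIdeal R M) :
    σ c ∈ finFreeIdeal R M := by
  obtain ⟨n, φ, y, hφ⟩ := hc
  refine ⟨n, fun i => conjDual σ t h (φ i), fun i => t (y i), fun x => ?_⟩
  have := congrArg t (hφ (t.symm x))
  simpa [h, conjDual] using this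

/-- Over a reduced nonzero ring, multiplication by some nonzero scalar on a finitely generated
module factors through a finite free module. -/
theorem finFreeIdeal_ne_bot [Nontrivial R] [IsReduced R] [Module.Finite R M] :
    finFreeIdeal R M ≠ ⊥ := by
  -- Choose `f ≠ 0` and `y₁, …, yₙ` with `f M ⊆ ⟨y₁, …, yₙ⟩` and `n` minimal.
  let Q : ℕ → Prop := fun n => ∃ (f : R) (y : Fin n → M), f ≠ 0 ∧
    ∀ x, f • x ∈ Submodule.span R (Set.range y)
  have hQ : ∃ n, Q n := by
    obtain ⟨n, y, hy⟩ := Module.Finite.exists_fin (R := R) (M := M)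
    exact ⟨n, 1, y, one_ne_zero, fun x => hy ▸ Submodule.mem_top⟩
  classical
  obtain ⟨f, y, hf, hy⟩ := Nat.find_spec hQ
  have hmin := fun k => Nat.find_min (m := k) hQ
  generalize Nat.find hQ = n at y hy hmin
  -- By minimality, `f` kills the coefficients of every relation between the `yᵢ`.
  have key : ∀ a : Fin n → R, ∑ i, a i • y i = 0 → ∀ i, f * a i = 0 := by
    intro a ha i
    by_contra hne
    cases n with
    | zero => exact i.elim0
    | succ n =>
      refine hmin n (Nat.lt_succ_self n) ⟨f * a i, fun j => y (i.succAbove j), hne, fun x => ?_⟩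
      have hi : a i • y i ∈ Submodule.span R (Set.range fun j => y (i.succAbove j)) := by
        rw [Fin.sum_univ_succAbove _ i] at ha
        rw [eq_neg_of_add_eq_zero_left ha]
        exact neg_mem (sum_mem fun j _ => Submodule.smul_mem _ _
          (Submodule.subset_span ⟨j, rfl⟩))
      obtain ⟨b, hb⟩ := (Submodule.mem_span_range_iff_exists_fun R).mp (hy x)
      rw [mul_comm, mul_smul, ← hb, Finset.smul_sum]
      refine sum_mem fun j _ => ?_
      rw [smul_comm]
      refine Submodule.smul_mem _ _ ?_
      rcases eq_or_ne j i with rfl | hj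
      · exact hi
      · obtain ⟨k, rfl⟩ := Fin.exists_succAbove_eq hj
        exact Submodule.smul_mem _ _ (Submodule.subset_span ⟨k, rfl⟩)
  -- Coefficients `b x` of `f • x` are not unique, but `f * b x i` is, hence linear in `x`.
  choose b hb using fun x => (Submodule.mem_span_range_iff_exists_fun R).mp (hy x)
  have hadd : ∀ x x' i, f * b (x + x') i = f * b x i + f * b x' i := by
    intro x x' i
    have := key (fun i => b (x + x') i - b x i - b x' i)
      (by simp [sub_smul, Finset.sum_sub_distrib, hb]) i
    linear_combination this
  have hsmul : ∀ (r : R) x i, f * b (r • x) i = r * (f * b x i) := by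
    intro r x i
    have := key (fun i => b (r • x) i - r * b x i)
      (by simp [sub_smul, mul_smul, Finset.sum_sub_distrib, ← Finset.smul_sum, hb,
        smul_comm r f]) i
    linear_combination this
  let φ : Fin n → Module.Dual R M := fun i =>
    { toFun := fun x => f * b x i
      map_add' := fun x x' => hadd x x' i
      map_smul' := fun r x => hsmul r x i }
  have hmem : f * f ∈ finFreeIdeal R M :=
    ⟨n, φ, y, fun x => by simp [φ, mul_smul, ← Finset.smul_sum, hb]⟩
  intro hbot
  rw [hbot, Ideal.mem_bot] at hmem
  exact hf (IsNilpotent.eq_zero ⟨2, by rw [sq, hmem]⟩)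

/-- A finitely generated module with a semilinear bijection over a simple difference ring is
projective. -/
theorem IsSimpleDifferenceRing.projective [DifferenceRing R] (hR : IsSimpleDifferenceRing R)
    [Module.Finite R M] (t : M ≃+ M)
    (ht : ∀ (r : R) (x : M), t (r • x) = DifferenceRing.tau r • t x) :
    Module.Projective R M := by
  have := hR.nontrivial
  have := hR.isReduced
  have ht' : ∀ (r : R) (x : M), t.symm (r • x) = DifferenceRing.tau.symm r • t.symm x := by
    intro r x
    rw [AddEquiv.symm_apply_eq, ht]; simp
  refine projective_of_one_mem_finFreeIdeal ?_
  rw [(hR.ideal_eq_bot_or_eq_top (finFreeIdeal R M) fun c => ⟨fun h => ?_,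
    map_mem_finFreeIdeal _ t ht⟩).resolve_left finFreeIdeal_ne_bot]
  · exact Submodule.mem_top
  · simpa using map_mem_finFreeIdeal _ t.symm ht' h

end FiniteProjective

/-! ### Purity and locally finite difference algebras -/

section Purity

variable {R : Type*} [CommRing R] [DifferenceRing R] {M : Type*} [AddCommGroup M] [Module R M]

/-- A semilinear bijection as a semilinear map. -/
def AddEquiv.toSemilinearMap {σ : R ≃+* R} (t : M ≃+ M)
    (ht : ∀ (r : R) (x : M), t (r • x) = σ r • t x) : M →ₛₗ[(σ : R →+* R)] M where
  toFun := t
  map_add' := map_add t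
  map_smul' := ht

/-- The semilinear bijection induced on the quotient by a stable submodule. -/
def AddEquiv.quotientOfStable {σ : R ≃+* R} (t : M ≃+ M)
    (ht : ∀ (r : R) (x : M), t (r • x) = σ r • t x) (F : Submodule R M)
    (hF : ∀ x, t x ∈ F ↔ x ∈ F) : (M ⧸ F) ≃+ (M ⧸ F) :=
  have ht' : ∀ (r : R) (x : M), t.symm (r • x) = σ.symm r • t.symm x := fun r x => by
    rw [AddEquiv.symm_apply_eq, ht]; simp
  { F.mapQ F (t.toSemilinearMap ht) fun x hx => (hF x).mpr hx with
    invFun := F.mapQ F (t.symm.toSemilinearMap ht') fun x hx =>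
      (hF _).mp ((t.apply_symm_apply x).symm ▸ hx)
    left_inv := fun x => by
      obtain ⟨x, rfl⟩ := F.mkQ_surjective x
      exact congrArg F.mkQ (t.symm_apply_apply x)
    right_inv := fun x => by
      obtain ⟨x, rfl⟩ := F.mkQ_surjective x
      exact congrArg F.mkQ (t.apply_symm_apply x) }

/-- A stable submodule of a finitely generated difference module over a simple difference ring is
pure: the quotient is projective, so the submodule is a direct summand. -/
theorem IsSimpleDifferenceRing.mem_smul_of_mem_smul_top (hR : IsSimpleDifferenceRing R)
    [Module.Finite R M] (t : M ≃+ M)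
    (ht : ∀ (r : R) (x : M), t (r • x) = DifferenceRing.tau r • t x) (F : Submodule R M)
    (hF : ∀ x, t x ∈ F ↔ x ∈ F) (I : Ideal R) {x : M} (hx : x ∈ F)
    (hxI : x ∈ I • (⊤ : Submodule R M)) : x ∈ I • F := by
  have : Module.Projective R (M ⧸ F) := by
    refine hR.projective (t.quotientOfStable ht F hF) fun r y => ?_
    exact map_smulₛₗ (F.mapQ F (t.toSemilinearMap ht) fun x hx => (hF x).mpr hx) r y
  obtain ⟨s, hs⟩ := Module.projective_lifting_property F.mkQ LinearMap.id F.mkQ_surjective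
  let p : M →ₗ[R] M := LinearMap.id - s.comp F.mkQ
  have hp : LinearMap.range p ≤ F := by
    rintro _ ⟨y, rfl⟩
    rw [← Submodule.ker_mkQ F, LinearMap.mem_ker]
    have := LinearMap.congr_fun hs (F.mkQ y)
    simp only [LinearMap.comp_apply, LinearMap.id_apply] at this
    simp only [p, LinearMap.sub_apply, LinearMap.comp_apply, LinearMap.id_apply, map_sub, this,
      sub_self]
  have hpx : p x = x := by
    simp [p, (Submodule.Quotient.mk_eq_zero F).mpr hx]
  have : p x ∈ (I • (⊤ : Submodule R M)).map p := Submodule.mem_map_of_mem hxI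
  rw [hpx, Submodule.map_smul'', Submodule.map_top] at this
  exact (smul_mono_right I hp : I • LinearMap.range p ≤ I • F) this

end Purity

section LocallyFinite

theorem IsSimpleDifferenceRing.injective {R S : Type*} [CommRing R] [DifferenceRing R] [CommRing S]
    [DifferenceRing S] [Nontrivial S] (hR : IsSimpleDifferenceRing R) (f : R →+* S)
    (hf : ∀ r, f (DifferenceRing.tau r) = DifferenceRing.tau (f r)) : Function.Injective f := by
  rw [RingHom.injective_iff_ker_eq_bot]
  refine (hR.ideal_eq_bot_or_eq_top _ fun r => ?_).resolve_right (RingHom.ker_ne_top _)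
  simp [RingHom.mem_ker, hf]

variable {R S : Type*} [CommRing R] [CommRing S] [Algebra R S]

theorem Submodule.fg_one_of_algebra : (1 : Submodule R S).FG := by
  rw [Submodule.one_eq_span]
  exact Submodule.fg_span_singleton 1

variable [DifferenceRing S]

/-- An `R`-submodule of a difference algebra is stable if `τ` restricts to a bijection of it. -/
def IsTauStable (N : Submodule R S) : Prop :=
  ∀ s, DifferenceRing.tau s ∈ N ↔ s ∈ N

theorem isTauStable_iff {N : Submodule R S} : IsTauStable N ↔
    (∀ s ∈ N, DifferenceRing.tau s ∈ N) ∧ ∀ s ∈ N, DifferenceRing.tau.symm s ∈ N := by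
  refine ⟨fun h => ⟨fun s => (h s).mpr, fun s hs => (h _).mp (by simpa using hs)⟩,
    fun h s => ⟨fun hs => by simpa using h.2 _ hs, h.1 s⟩⟩

variable [DifferenceRing R] [DifferenceAlgebra R S]

theorem isTauStable_span {G : Set S}
    (h : ∀ g ∈ G, DifferenceRing.tau g ∈ Submodule.span R G)
    (h' : ∀ g ∈ G, DifferenceRing.tau.symm g ∈ Submodule.span R G) :
    IsTauStable (Submodule.span R G) := by
  rw [isTauStable_iff]
  constructor
  · intro s hs
    induction hs using Submodule.span_induction with
    | mem x hx => exact h x hx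
    | zero => simp
    | add x y _ _ hx hy => rw [map_add]; exact add_mem hx hy
    | smul r x _ hx => rw [DifferenceAlgebra.tau_smul]; exact Submodule.smul_mem _ _ hx
  · intro s hs
    induction hs using Submodule.span_induction with
    | mem x hx => exact h' x hx
    | zero => simp
    | add x y _ _ hx hy => rw [map_add]; exact add_mem hx hy
    | smul r x _ hx => rw [DifferenceAlgebra.tau_symm_smul]; exact Submodule.smul_mem _ _ hx

theorem IsTauStable.sup {N N' : Submodule R S} (h : IsTauStable N) (h' : IsTauStable N') :
    IsTauStable (N ⊔ N') := by
  rw [← Submodule.span_eq N, ← Submodule.span_eq N', ← Submodule.span_union]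
  have hN : N ≤ Submodule.span R (N ∪ N') := fun x hx => Submodule.subset_span (.inl hx)
  have hN' : N' ≤ Submodule.span R (N ∪ N') := fun x hx => Submodule.subset_span (.inr hx)
  rw [isTauStable_iff] at h h'
  refine isTauStable_span ?_ ?_
  · rintro g (hg | hg)
    exacts [hN (h.1 g hg), hN' (h'.1 g hg)]
  · rintro g (hg | hg)
    exacts [hN (h.2 g hg), hN' (h'.2 g hg)]

theorem IsTauStable.mul {N N' : Submodule R S} (h : IsTauStable N) (h' : IsTauStable N') :
    IsTauStable (N * N') := by
  rw [isTauStable_iff] at h h'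
  rw [Submodule.mul_eq_span_mul_set]
  refine isTauStable_span ?_ ?_
  · rintro _ ⟨a, ha, b, hb, rfl⟩
    exact Submodule.subset_span ⟨_, h.1 a ha, _, h'.1 b hb, (map_mul _ _ _).symm⟩
  · rintro _ ⟨a, ha, b, hb, rfl⟩
    exact Submodule.subset_span ⟨_, h.2 a ha, _, h'.2 b hb, (map_mul _ _ _).symm⟩

theorem isTauStable_one : IsTauStable (1 : Submodule R S) := by
  rw [Submodule.one_eq_span]
  refine isTauStable_span ?_ ?_ <;> rintro g rfl <;> simp

variable (R S)

/-- The subalgebra of elements contained in a finitely generated stable `R`-submodule. -/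
def locallyFiniteSubalgebra : Subalgebra R S where
  carrier := {s | ∃ N : Submodule R S, N.FG ∧ IsTauStable N ∧ s ∈ N}
  mul_mem' := by
    rintro a b ⟨N, hN, hNt, ha⟩ ⟨N', hN', hNt', hb⟩
    exact ⟨N * N', hN.mul hN', hNt.mul hNt', Submodule.mul_mem_mul ha hb⟩
  add_mem' := by
    rintro a b ⟨N, hN, hNt, ha⟩ ⟨N', hN', hNt', hb⟩
    exact ⟨N ⊔ N', hN.sup hN', hNt.sup hNt', add_mem (Submodule.mem_sup_left ha)
      (Submodule.mem_sup_right hb)⟩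
  algebraMap_mem' r := ⟨1, Submodule.fg_one_of_algebra, isTauStable_one,
    Submodule.mem_one.mpr ⟨r, rfl⟩⟩

variable {R S}

theorem exists_fg_isTauStable_of_finset (h : locallyFiniteSubalgebra R S = ⊤) (s : Finset S) :
    ∃ N : Submodule R S, N.FG ∧ IsTauStable N ∧ ∀ x ∈ s, x ∈ N := by
  classical
  induction s using Finset.induction_on with
  | empty => exact ⟨1, Submodule.fg_one_of_algebra, isTauStable_one, by simp⟩
  | insert a s _ ih =>
    obtain ⟨N, hN, hNt, hs⟩ := ih
    obtain ⟨N', hN', hNt', ha⟩ : a ∈ locallyFiniteSubalgebra R S := h ▸ Algebra.mem_top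
    refine ⟨N ⊔ N', hN.sup hN', hNt.sup hNt', fun x hx => ?_⟩
    rcases Finset.mem_insert.mp hx with rfl | hx
    · exact Submodule.mem_sup_right ha
    · exact Submodule.mem_sup_left (hs x hx)

/-- The bijection induced by `τ` on a stable submodule. -/
def IsTauStable.equiv {N : Submodule R S} (h : IsTauStable N) : N ≃+ N where
  toFun x := ⟨DifferenceRing.tau x.1, (h _).mpr x.2⟩
  invFun x := ⟨DifferenceRing.tau.symm x.1, (isTauStable_iff.mp h).2 _ x.2⟩
  left_inv x := by simp
  right_inv x := by simp
  map_add' x y := by ext; simp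

theorem IsTauStable.equiv_smul {N : Submodule R S} (h : IsTauStable N) (r : R) (x : N) :
    h.equiv (r • x) = DifferenceRing.tau r • h.equiv x := by
  ext; exact DifferenceAlgebra.tau_smul R S r x

/-- In a locally finite difference algebra over a simple difference ring, finitely generated stable
submodules are pure. -/
theorem IsTauStable.mem_smul_of_mem_smul_top (hR : IsSimpleDifferenceRing R)
    (h : locallyFiniteSubalgebra R S = ⊤) {F : Submodule R S} (hFfg : F.FG) (hF : IsTauStable F)
    (I : Ideal R) {x : S} (hx : x ∈ F) (hxI : x ∈ I • (⊤ : Submodule R S)) : x ∈ I • F := by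
  have hN : ∃ N : Submodule R S, N.FG ∧ IsTauStable N ∧ x ∈ I • N := by
    clear hx
    induction hxI using Submodule.smul_induction_on' with
    | smul r hr s _ =>
      obtain ⟨N, hN, hNt, hs⟩ : s ∈ locallyFiniteSubalgebra R S := h ▸ Algebra.mem_top
      exact ⟨N, hN, hNt, Submodule.smul_mem_smul hr hs⟩
    | add x _ y _ hx hy =>
      obtain ⟨N, hN, hNt, ha⟩ := hx
      obtain ⟨N', hN', hNt', hb⟩ := hy
      exact ⟨N ⊔ N', hN.sup hN', hNt.sup hNt',
        add_mem ((smul_mono_right I le_sup_left : I • N ≤ I • (N ⊔ N')) ha)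
          ((smul_mono_right I le_sup_right : I • N' ≤ I • (N ⊔ N')) hb)⟩
  obtain ⟨N, hNfg, hN, hxN⟩ := hN
  -- Work inside a finitely generated stable submodule containing both `F` and `N`.
  set L := N ⊔ F with hL
  have hLt : IsTauStable L := hN.sup hF
  have hLfg : L.FG := hNfg.sup hFfg
  have : Module.Finite R L := Module.Finite.iff_fg.mpr hLfg
  have hxL : x ∈ L := Submodule.mem_sup_right hx
  have h1 : (⟨x, hxL⟩ : L) ∈ I • (⊤ : Submodule R L) := by
    have h2 : x ∈ I • L := (smul_mono_right I le_sup_left : I • N ≤ I • L) hxN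
    have h3 : (I • (⊤ : Submodule R L)).map L.subtype = I • L := by
      rw [Submodule.map_smul'', Submodule.map_top, Submodule.range_subtype]
    rw [← h3] at h2
    obtain ⟨y, hy, hyx⟩ := h2
    have hyx' : (⟨x, hxL⟩ : L) = y := Subtype.ext hyx.symm
    exact hyx' ▸ hy
  have h4 := hR.mem_smul_of_mem_smul_top hLt.equiv hLt.equiv_smul (F.comap L.subtype)
    (fun y => hF y.1) I (x := ⟨x, hxL⟩) hx h1
  have h5 := Submodule.mem_map_of_mem (f := L.subtype) h4
  rw [Submodule.map_smul''] at h5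
  exact (smul_mono_right I (Submodule.map_comap_le _ _) :
    I • (F.comap L.subtype).map L.subtype ≤ I • F) h5

theorem flat_of_locallyFinite (hR : IsSimpleDifferenceRing R)
    (h : locallyFiniteSubalgebra R S = ⊤) : Module.Flat R S := by
  classical
  refine Module.Flat.of_forall_isTrivialRelation fun {l f x} hfx => ?_
  obtain ⟨N, hNfg, hN, hx⟩ := exists_fg_isTauStable_of_finset h (Finset.univ.image x)
  have hx' : ∀ i, x i ∈ N := fun i => hx _ (Finset.mem_image_of_mem _ (Finset.mem_univ i))
  have : Module.Finite R N := Module.Finite.iff_fg.mpr hNfg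
  have : Module.Projective R N := hR.projective hN.equiv hN.equiv_smul
  have h0 : ∑ i, f i • (⟨x i, hx' i⟩ : N) = 0 := by
    ext; simpa using hfx
  obtain ⟨k, a, y, h1, h2⟩ := Module.Flat.isTrivialRelation_of_sum_smul_eq_zero h0
  exact ⟨k, a, fun j => y j, fun i => by simpa using congrArg N.subtype (h1 i), h2⟩

theorem algebraMap_injective_of_simple (hR : IsSimpleDifferenceRing R) [Nontrivial S] :
    Function.Injective (algebraMap R S) :=
  hR.injective _ DifferenceAlgebra.algebraMap_tau

theorem faithfullyFlat_of_locallyFinite (hR : IsSimpleDifferenceRing R) [Nontrivial S]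
    (h : locallyFiniteSubalgebra R S = ⊤) : Module.FaithfullyFlat R S := by
  have := flat_of_locallyFinite hR h
  refine ⟨fun m hm hmS => ?_⟩
  have h1 : (1 : S) ∈ m • (⊤ : Submodule R S) := hmS.symm ▸ Submodule.mem_top
  have h2 := isTauStable_one.mem_smul_of_mem_smul_top hR h Submodule.fg_one_of_algebra m
    (Submodule.mem_one.mpr ⟨1, map_one _⟩) h1
  have h3 : m • (1 : Submodule R S) = Submodule.map (Algebra.linearMap R S) m := by
    rw [Submodule.one_eq_range, ← Submodule.map_top, ← Submodule.map_smul'']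
    simp
  rw [h3] at h2
  obtain ⟨a, ha, ha1⟩ := h2
  have : a = 1 := algebraMap_injective_of_simple (S := S) hR (by simpa using ha1)
  exact hm.ne_top ((Ideal.eq_top_iff_one m).mpr (this ▸ ha))

end LocallyFinite

/-! ### Constants -/

section Polynomial
open Polynomial

/-- An algebra of finite type over `k[X]` in which `k[X]` embeds has points over all but finitely
many points of the affine line: being torsion-free it is flat, so the map of spectra is open. -/
theorem exists_not_isUnit_algebraMap_X_sub_C {k E : Type*} [Field k] [CommRing E] [IsDomain E]
    [Algebra k[X] E] [Algebra.FiniteType k[X] E]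
    (hinj : Function.Injective (algebraMap k[X] E)) {T : Set k} (hT : T.Infinite) :
    ∃ a ∈ T, ¬ IsUnit (algebraMap k[X] E (X - C a)) := by
  classical
  have : FaithfulSMul k[X] E := (faithfulSMul_iff_algebraMap_injective _ _).mpr hinj
  have : Module.IsTorsionFree k[X] E := inferInstance
  have : Module.Flat k[X] E := inferInstance
  have : Algebra.FinitePresentation k[X] E := Algebra.FinitePresentation.of_finiteType.mp ‹_›
  have hopen := (PrimeSpectrum.isOpenMap_comap_of_hasGoingDown_of_finitePresentation
    (R := k[X]) (S := E)).isOpen_range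
  obtain ⟨I, hI⟩ := (PrimeSpectrum.isClosed_iff_zeroLocus _).mp hopen.isClosed_compl
  have hbot : (⊥ : PrimeSpectrum k[X]) ∉ PrimeSpectrum.zeroLocus I := by
    rw [← hI]
    refine fun h => h ⟨⊥, PrimeSpectrum.ext ?_⟩
    change RingHom.ker (algebraMap k[X] E) = ⊥
    rwa [← RingHom.injective_iff_ker_eq_bot]
  obtain ⟨f, hfI, hf⟩ := Set.not_subset.mp hbot
  have hf0 : f ≠ 0 := hf
  obtain ⟨a, haT, ha⟩ := (hT.sdiff f.roots.toFinset.finite_toSet).nonempty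
  have hfa : f.eval a ≠ 0 := fun h => ha (by simpa [hf0] using h)
  refine ⟨a, haT, fun hu => ?_⟩
  have hprime : (Ideal.span {X - C a}).IsPrime :=
    (Ideal.span_singleton_prime (X_sub_C_ne_zero a)).mpr (prime_X_sub_C a)
  have hmem : (⟨_, hprime⟩ : PrimeSpectrum k[X]) ∈
      Set.range (PrimeSpectrum.comap (algebraMap k[X] E)) := by
    by_contra h
    have h' : (⟨_, hprime⟩ : PrimeSpectrum k[X]) ∈ PrimeSpectrum.zeroLocus I := hI ▸ h
    have := h' hfI
    rw [SetLike.mem_coe, Ideal.mem_span_singleton, dvd_iff_isRoot] at this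
    exact hfa this
  obtain ⟨q, hq⟩ := hmem
  have h1 : X - C a ∈ (PrimeSpectrum.comap (algebraMap k[X] E) q).asIdeal := by
    rw [hq]; exact Ideal.mem_span_singleton_self _
  exact q.2.ne_top (Ideal.eq_top_of_isUnit_mem _ h1 hu)

end Polynomial

section Constants

variable {R : Type*} [CommRing R] [DifferenceRing R]

theorem mem_differenceConstants {r : R} :
    r ∈ differenceConstants R ↔ DifferenceRing.tau r = r := Iff.rfl

theorem IsSimpleDifferenceRing.isUnit_of_mem_differenceConstants (hR : IsSimpleDifferenceRing R)
    {c : R} (hc : c ∈ differenceConstants R) (h0 : c ≠ 0) : IsUnit c := by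
  rw [mem_differenceConstants] at hc
  rw [← Ideal.span_singleton_eq_top]
  refine (hR.ideal_eq_bot_or_eq_top _ fun r => ?_).resolve_left (by simpa using h0)
  simp only [Ideal.mem_span_singleton]
  nth_rewrite 1 [← hc]
  exact map_dvd_iff (DifferenceRing.tau : R ≃+* R)

open Polynomial in
/-- A monic polynomial with constant coefficients is a product of linear factors with constant
roots, if the constants form an algebraically closed field. -/
theorem HasAlgClosedConstants.exists_eq_prod (hC : HasAlgClosedConstants R) {g : R[X]}
    (hg : g.Monic) (hgC : ∀ i, g.coeff i ∈ differenceConstants R) :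
    ∃ s : Multiset R, (∀ a ∈ s, a ∈ differenceConstants R) ∧
      g = (s.map fun a => X - C a).prod := by
  obtain ⟨hfield, halg⟩ := hC
  let : Field (differenceConstants R) := hfield.toField
  have hsub : (g.coeffs : Set R) ⊆ differenceConstants R := by
    intro x hx
    obtain ⟨i, -, rfl⟩ := Polynomial.mem_coeffs_iff.mp hx
    exact hgC i
  let g₀ : (differenceConstants R)[X] := g.toSubring (differenceConstants R) hsub
  have hmap : g₀.map (differenceConstants R).subtype = g := by
    ext i; simp [g₀]
  have hg₀ : g₀.Monic := (Polynomial.monic_toSubring g _ hsub).mpr hg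
  have hprod := (IsAlgClosed.splits g₀).eq_prod_roots_of_monic hg₀
  refine ⟨g₀.roots.map (differenceConstants R).subtype, ?_, ?_⟩
  · intro a ha
    obtain ⟨b, -, rfl⟩ := Multiset.mem_map.mp ha
    exact b.2
  · rw [← hmap]
    conv_lhs => rw [hprod]
    rw [Polynomial.map_multiset_prod, Multiset.map_map, Multiset.map_map]
    congr 1
    refine Multiset.map_congr rfl fun a _ => ?_
    simp

theorem HasAlgClosedConstants.infinite (hC : HasAlgClosedConstants R) :
    (differenceConstants R : Set R).Infinite := by
  obtain ⟨hfield, halg⟩ := hC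
  let : Field (differenceConstants R) := hfield.toField
  exact Set.infinite_coe_iff.mp (IsAlgClosed.instInfinite (K := differenceConstants R))

variable {S : Type*} [CommRing S] [DifferenceRing S] [Algebra R S] [DifferenceAlgebra R S]

open Polynomial in
theorem aeval_map_tau {t : S} (ht : t ∈ differenceConstants S) (p : R[X]) :
    aeval t (p.map (DifferenceRing.tau : R ≃+* R).toRingHom) = DifferenceRing.tau (aeval t p) := by
  rw [mem_differenceConstants] at ht
  induction p using Polynomial.induction_on' with
  | add p q hp hq => simp only [Polynomial.map_add, map_add, hp, hq]
  | monomial n a =>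
    simp [aeval_monomial, DifferenceAlgebra.algebraMap_tau, ht]

theorem isUnit_sub_algebraMap (hS : IsSimpleDifferenceRing S) {t : S}
    (ht : t ∈ differenceConstants S) (hne : t ∉ (differenceConstants R).map (algebraMap R S))
    {a : R} (ha : a ∈ differenceConstants R) : IsUnit (t - algebraMap R S a) := by
  refine hS.isUnit_of_mem_differenceConstants (sub_mem ht ?_) fun h => ?_
  · rw [mem_differenceConstants] at ha ⊢
    rw [← DifferenceAlgebra.algebraMap_tau, ha]
  · exact hne ⟨a, ha, (sub_eq_zero.mp h).symm⟩

open Polynomial in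
/-- A constant of `S` that does not come from `R` is transcendental over `R`: a polynomial relation
of minimal degree may be taken monic, and then its coefficients are constants. -/
theorem aeval_injective_of_constant (hR : IsSimpleDifferenceRing R)
    (hC : HasAlgClosedConstants R) (hS : IsSimpleDifferenceRing S) {t : S}
    (ht : t ∈ differenceConstants S) (hne : t ∉ (differenceConstants R).map (algebraMap R S)) :
    Function.Injective (aeval (R := R) t) := by
  have hS' := hS.nontrivial
  have hR' := hR.nontrivial
  set K : Ideal R[X] := RingHom.ker (aeval (R := R) t) with hK
  by_contra hinj
  have hex : ∃ d, ∃ p ∈ K, p ≠ 0 ∧ p.natDegree = d := by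
    rw [injective_iff_map_eq_zero] at hinj
    push Not at hinj
    obtain ⟨p, hp, hp0⟩ := hinj
    exact ⟨_, p, hp, hp0, rfl⟩
  classical
  obtain ⟨p, hpK, hp0, hpd⟩ := Nat.find_spec hex
  have hmin := fun k => Nat.find_min (m := k) hex
  generalize Nat.find hex = d at hpd hmin
  have hstep : ∀ q ∈ K, q.map (DifferenceRing.tau : R ≃+* R).toRingHom ∈ K := by
    intro q hq
    rw [hK, RingHom.mem_ker] at hq ⊢
    rw [aeval_map_tau ht, hq, map_zero]
  have hstep' : ∀ q : R[X], q.map (DifferenceRing.tau : R ≃+* R).toRingHom ∈ K → q ∈ K := by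
    intro q hq
    rw [hK, RingHom.mem_ker] at hq ⊢
    rw [aeval_map_tau ht] at hq
    simpa using hq
  have hinjτ : Function.Injective (DifferenceRing.tau : R ≃+* R).toRingHom :=
    (DifferenceRing.tau : R ≃+* R).injective
  -- The leading coefficients in degree `d` form a stable ideal, so `K` has a monic element `g` of
  -- degree `d`; minimality of `d` then forces `τ g = g`.
  have hone : (1 : R) ∈ K.leadingCoeffNth d := by
    have := (hR.ideal_eq_bot_or_eq_top (K.leadingCoeffNth d) fun r => ?_).resolve_left ?_
    · rw [this]; exact Submodule.mem_top
    · simp only [Ideal.mem_leadingCoeffNth]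
      constructor
      · rintro ⟨q, hq, hqd, hqr⟩
        refine ⟨q.map (DifferenceRing.tau.symm : R ≃+* R).toRingHom, hstep' _ ?_,
          degree_map_le.trans hqd, ?_⟩
        · rw [Polynomial.map_map]
          convert hq
          convert Polynomial.map_id
          ext; simp
        · rw [leadingCoeff_map_of_injective _, hqr]
          · simp
          · exact (DifferenceRing.tau.symm : R ≃+* R).injective
      · rintro ⟨q, hq, hqd, rfl⟩
        exact ⟨_, hstep q hq, degree_map_le.trans hqd, leadingCoeff_map_of_injective hinjτ _⟩
    · intro hbot
      have : p.leadingCoeff ∈ K.leadingCoeffNth d :=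
        (Ideal.mem_leadingCoeffNth _ _ _).mpr ⟨p, hpK, hpd ▸ degree_le_natDegree, rfl⟩
      rw [hbot, Ideal.mem_bot, leadingCoeff_eq_zero] at this
      exact hp0 this
  obtain ⟨g, hgK, hgd, hg1⟩ := (Ideal.mem_leadingCoeffNth _ _ _).mp hone
  have hg : g.Monic := hg1
  have hconst : g.map (DifferenceRing.tau : R ≃+* R).toRingHom = g := by
    by_contra hne'
    have hdeg : (g.map (DifferenceRing.tau : R ≃+* R).toRingHom - g).degree < d := by
      refine lt_of_lt_of_le (degree_sub_lt_left (degree_map_eq_of_injective hinjτ _)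
        ((Polynomial.map_ne_zero_iff hinjτ).mpr hg.ne_zero) ?_)
        (degree_map_le.trans hgd)
      rw [(hg.map _).leadingCoeff, hg.leadingCoeff]
    have h0 := sub_ne_zero.mpr hne'
    exact hmin _ ((natDegree_lt_iff_degree_lt h0).mpr hdeg)
      ⟨_, sub_mem (hstep g hgK) hgK, h0, rfl⟩
  obtain ⟨s, hs, hgs⟩ := hC.exists_eq_prod hg fun i => by
    have := congrArg (fun q => coeff q i) hconst
    rw [mem_differenceConstants]
    simpa using this
  have hunit : IsUnit (aeval t g) := by
    rw [hgs, map_multiset_prod, Multiset.map_map]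
    refine Multiset.prod_induction IsUnit _ (fun _ _ => IsUnit.mul) isUnit_one ?_
    intro x hx
    obtain ⟨a, ha, rfl⟩ := Multiset.mem_map.mp hx
    simpa using isUnit_sub_algebraMap hS ht hne (hs a ha)
  have h0 : aeval t g = 0 := hgK
  rw [h0] at hunit
  exact not_isUnit_zero hunit

open Polynomial in
/-- The stable submodule spanned by the first powers of a constant. -/
theorem isTauStable_map_degreeLT {t : S} (ht : t ∈ differenceConstants S) (n : ℕ) :
    IsTauStable ((degreeLT R n).map (aeval (R := R) t).toLinearMap) := by
  classical
  rw [mem_differenceConstants] at ht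
  rw [degreeLT_eq_span_X_pow, Submodule.map_span]
  have ht' : DifferenceRing.tau.symm t = t := by
    rw [RingEquiv.symm_apply_eq, ht]
  refine isTauStable_span ?_ ?_
  all_goals
    rintro _ ⟨p, hp, rfl⟩
    obtain ⟨i, hi, rfl⟩ := Finset.mem_image.mp hp
    refine Submodule.subset_span ⟨X ^ i, hp, ?_⟩
    simp [ht, ht']

open Polynomial in
/-- No new constants appear in a simple, finitely generated and locally finite difference algebra
over a simple difference ring with algebraically closed field of constants. -/
theorem differenceConstants_eq_map (hR : IsSimpleDifferenceRing R)
    (hC : HasAlgClosedConstants R) (hS : IsSimpleDifferenceRing S)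
    (hfin : Algebra.FiniteType R S) (hlf : locallyFiniteSubalgebra R S = ⊤) :
    differenceConstants S = (differenceConstants R).map (algebraMap R S) := by
  classical
  have hS' := hS.nontrivial
  have hR' := hR.nontrivial
  refine le_antisymm (fun t ht => ?_) ?_
  swap
  · rintro _ ⟨a, ha, rfl⟩
    change DifferenceRing.tau (algebraMap R S a) = algebraMap R S a
    rw [← DifferenceAlgebra.algebraMap_tau]
    exact congrArg _ ha
  by_contra hne
  have hinj := aeval_injective_of_constant hR hC hS ht hne
  obtain ⟨m, hm⟩ := Ideal.exists_maximal R
  let := Ideal.Quotient.field m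
  -- By purity, the fibre of `R[X] → S` over the maximal ideal `m` is still injective.
  have hpure : ∀ p : R[X], aeval t p ∈ m.map (algebraMap R S) →
      p.map (Ideal.Quotient.mk m) = 0 := by
    intro p hp
    have h1 : aeval t p ∈ m • (⊤ : Submodule R S) := by
      rw [Ideal.smul_top_eq_map]; exact hp
    set n := p.natDegree + 1
    have h2 : aeval t p ∈ (degreeLT R n).map (aeval (R := R) t).toLinearMap :=
      ⟨p, mem_degreeLT.mpr (lt_of_le_of_lt degree_le_natDegree (by
        exact_mod_cast Nat.lt_succ_self _)), rfl⟩
    have h3 : ((degreeLT R n).map (aeval (R := R) t).toLinearMap).FG := by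
      rw [degreeLT_eq_span_X_pow]
      exact (Submodule.FG.map _ ⟨_, rfl⟩)
    have h4 := (isTauStable_map_degreeLT ht n).mem_smul_of_mem_smul_top hR hlf h3 m h2 h1
    rw [← Submodule.map_smul''] at h4
    obtain ⟨q, hq, hqp⟩ := h4
    obtain rfl : q = p := hinj hqp
    clear h1 h2 h3 hqp hp
    generalize n = n at hq
    induction hq using Submodule.smul_induction_on' with
    | smul r hr s _ =>
      rw [smul_eq_C_mul, Polynomial.map_mul, map_C, Ideal.Quotient.eq_zero_iff_mem.mpr hr]; simp
    | add x _ y _ hx hy => rw [Polynomial.map_add, hx, hy, add_zero]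
  -- Hence some prime `q` of `S` lies over the prime `m R[X]`.
  let π : R[X] →+* (R ⧸ m)[X] := mapRingHom (Ideal.Quotient.mk m)
  have hπ : Function.Surjective π := map_surjective _ Ideal.Quotient.mk_surjective
  have hprime : (RingHom.ker π).IsPrime := RingHom.ker_isPrime π
  have hker : (RingHom.ker π).map (aeval (R := R) t : R[X] →+* S) ≤ m.map (algebraMap R S) := by
    rw [ker_mapRingHom, Ideal.mk_ker, Ideal.map_map]
    refine le_of_eq ?_
    congr 1
    ext r; simp
  obtain ⟨q, hq, hqc⟩ := (Ideal.comap_map_eq_self_iff_of_isPrime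
    (f := (aeval (R := R) t : R[X] →+* S)) (RingHom.ker π)).mp <|
      le_antisymm (fun p hp => hpure p (hker hp)) Ideal.le_comap_map
  let g : (R ⧸ m)[X] →+* S ⧸ q := π.liftOfSurjective hπ
    ⟨(Ideal.Quotient.mk q).comp (aeval (R := R) t : R[X] →+* S), fun p hp => by
      rw [← hqc] at hp
      exact Ideal.Quotient.eq_zero_iff_mem.mpr hp⟩
  have hg : ∀ p, g (π p) = Ideal.Quotient.mk q (aeval t p) := fun p =>
    π.liftOfRightInverse_comp_apply _ _ _ p
  let := g.toAlgebra
  have hginj : Function.Injective g := by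
    rw [injective_iff_map_eq_zero]
    intro p hp
    obtain ⟨p, rfl⟩ := hπ p
    rw [hg, Ideal.Quotient.eq_zero_iff_mem] at hp
    have : p ∈ RingHom.ker π := by rw [← hqc]; exact hp
    exact this
  have hgfin : Algebra.FiniteType (R ⧸ m)[X] (S ⧸ q) := by
    have h1 : ((Ideal.Quotient.mk q).comp (algebraMap R S)).FiniteType :=
      (RingHom.FiniteType.of_surjective _ Ideal.Quotient.mk_surjective).comp
        (RingHom.finiteType_algebraMap.mpr hfin)
    have h2 : (g.comp (π.comp C)).FiniteType := by
      convert h1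
      ext r
      simp [hg]
    exact RingHom.FiniteType.of_comp_finiteType h2
  have hT : (Ideal.Quotient.mk m '' (differenceConstants R : Set R)).Infinite := by
    refine hC.infinite.image fun a ha b hb hab => ?_
    by_contra hab'
    refine hm.ne_top (Ideal.eq_top_of_isUnit_mem _ (Ideal.Quotient.eq.mp hab) ?_)
    exact hR.isUnit_of_mem_differenceConstants (sub_mem ha hb) (sub_ne_zero.mpr hab')
  obtain ⟨_, ⟨a, ha, rfl⟩, hnu⟩ := exists_not_isUnit_algebraMap_X_sub_C hginj hT
  refine hnu ?_
  change IsUnit (g (X - C (Ideal.Quotient.mk m a)))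
  have : X - C (Ideal.Quotient.mk m a) = π (X - C a) := by simp [π]
  rw [this, hg]
  have := (isUnit_sub_algebraMap hS ht hne ha).map (Ideal.Quotient.mk q)
  simpa using this

end Constants

/-! ### Simple quotients and tensor products -/

section SimpleQuotient

variable {T : Type u} [CommRing T] [DifferenceRing T]

/-- Every nonzero difference ring has a proper stable ideal that is maximal among these. -/
theorem exists_maximal_stable_ideal [Nontrivial T] : ∃ I : Ideal T,
    (∀ x, DifferenceRing.tau x ∈ I ↔ x ∈ I) ∧ I ≠ ⊤ ∧
    ∀ J : Ideal T, (∀ x, DifferenceRing.tau x ∈ J ↔ x ∈ J) → I ≤ J → J = I ∨ J = ⊤ := by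
  obtain ⟨I, hI⟩ := zorn_le₀
    {I : Ideal T | (∀ x, DifferenceRing.tau x ∈ I ↔ x ∈ I) ∧ I ≠ ⊤} (by
      intro c hc hchain
      rcases c.eq_empty_or_nonempty with rfl | hne
      · exact ⟨⊥, ⟨by simp, bot_ne_top⟩, by simp⟩
      · have hmem : ∀ x, x ∈ sSup c ↔ ∃ I ∈ c, x ∈ I := fun x =>
          Submodule.mem_sSup_of_directed hne hchain.directedOn
        refine ⟨sSup c, ⟨fun x => ?_, fun h => ?_⟩, fun I hI => le_sSup hI⟩
        · rw [hmem, hmem]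
          exact exists_congr fun I => and_congr_right fun hI => (hc hI).1 x
        · obtain ⟨I, hI, h1⟩ := (hmem 1).mp (h ▸ Submodule.mem_top)
          exact (hc hI).2 ((Ideal.eq_top_iff_one I).mpr h1))
  refine ⟨I, hI.prop.1, hI.prop.2, fun J hJ hle => ?_⟩
  by_contra! h
  exact h.1 (le_antisymm (hI.le_of_ge ⟨hJ, h.2⟩ hle) hle)

/-- The automorphism induced by `τ` on the quotient by a stable ideal. -/
@[reducible] def DifferenceRing.quotient (I : Ideal T)
    (hI : ∀ x, DifferenceRing.tau x ∈ I ↔ x ∈ I) : DifferenceRing (T ⧸ I) where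
  tau := Ideal.quotientEquiv I I DifferenceRing.tau <| by
    ext x
    rw [Ideal.mem_map_iff_of_surjective ((DifferenceRing.tau : T ≃+* T) : T →+* T)
      (DifferenceRing.tau : T ≃+* T).surjective]
    constructor
    · intro hx
      exact ⟨DifferenceRing.tau.symm x, (hI _).mp (by simpa using hx), by simp⟩
    · rintro ⟨y, hy, rfl⟩
      exact (hI y).mpr hy

/-- Every nonzero difference ring has a simple quotient. -/
theorem exists_simple_quotient [Nontrivial T] :
    ∃ (Q : Type u) (_ : CommRing Q) (_ : DifferenceRing Q) (π : T →+* Q),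
      Function.Surjective π ∧ (∀ x, π (DifferenceRing.tau x) = DifferenceRing.tau (π x)) ∧
      IsSimpleDifferenceRing Q := by
  obtain ⟨I, hI, hIt, hmax⟩ := exists_maximal_stable_ideal (T := T)
  let := DifferenceRing.quotient I hI
  have hτ : ∀ x, Ideal.Quotient.mk I (DifferenceRing.tau x) =
      DifferenceRing.tau (Ideal.Quotient.mk I x) := fun x => rfl
  refine ⟨T ⧸ I, inferInstance, inferInstance, Ideal.Quotient.mk I,
    Ideal.Quotient.mk_surjective, hτ, Ideal.Quotient.nontrivial_iff.mpr hIt, fun N hN => ?_⟩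
  have hmap := Ideal.map_comap_of_surjective _ (Ideal.Quotient.mk_surjective (I := I)) N
  have hstable : ∀ x, DifferenceRing.tau x ∈ Ideal.comap (Ideal.Quotient.mk I) N ↔
      x ∈ Ideal.comap (Ideal.Quotient.mk I) N := fun x => hN (Ideal.Quotient.mk I x)
  have hle : I ≤ Ideal.comap (Ideal.Quotient.mk I) N := fun x hx => by
    rw [Ideal.mem_comap, Ideal.Quotient.eq_zero_iff_mem.mpr hx]
    exact zero_mem _
  rcases hmax _ hstable hle with h | h
  · exact .inl (by rw [← hmap, h, Ideal.map_quotient_self])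
  · exact .inr (by rw [← hmap, h, Ideal.map_top])

end SimpleQuotient

section Tensor

variable (R S S' : Type*) [CommRing R] [DifferenceRing R] [CommRing S] [DifferenceRing S]
  [Algebra R S] [DifferenceAlgebra R S] [CommRing S'] [DifferenceRing S']
  [Algebra R S'] [DifferenceAlgebra R S']

/-- A difference algebra as a difference module over the base. -/
@[reducible] def DifferenceAlgebra.toDifferenceModule : DifferenceModule R S where
  tau := (DifferenceRing.tau : S ≃+* S).toAddEquiv
  tau_smul := DifferenceAlgebra.tau_smul R S

/-- The tensor product of two difference algebras, with `τ (s ⊗ s') = τ s ⊗ τ s'`. -/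
@[reducible] def DifferenceRing.tensorProduct : DifferenceRing (S ⊗[R] S') :=
  letI := DifferenceAlgebra.toDifferenceModule R S'
  { tau :=
    { (DifferenceModule.tau S : S ⊗[R] S' ≃+ S ⊗[R] S') with
      map_mul' := fun x y => by
        change DifferenceModule.tau S (x * y) = DifferenceModule.tau S x * DifferenceModule.tau S y
        induction x with
        | zero => simp
        | add x x' hx hx' => rw [add_mul, map_add, map_add, hx, hx', add_mul]
        | tmul s t =>
          induction y with
          | zero => simp
          | add y y' hy hy' => rw [mul_add, map_add, map_add, hy, hy', mul_add]
          | tmul s' t' =>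
            simp only [Algebra.TensorProduct.tmul_mul_tmul, DifferenceModule.baseChange_tau_tmul,
              map_mul]
            congr 1
            exact map_mul (DifferenceRing.tau : S' ≃+* S') t t' } }

end Tensor

/-! ### Solutions of difference systems -/

section Entries

variable {R S : Type*} [CommRing R] [CommRing S] [Algebra R S] {m : ℕ}

theorem Matrix.map_algebraMap_map {σ : R ≃+* R} {σ' : S ≃+* S}
    (hσ : ∀ r, σ' (algebraMap R S r) = algebraMap R S (σ r)) (X : Matrix (Fin m) (Fin m) R) :
    (X.map (algebraMap R S)).map σ' = (X.map σ).map (algebraMap R S) := by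
  ext i j; simp [hσ]

variable (R) in
/-- The subalgebra generated by the entries of two matrices. -/
def entryAlgebra {n : ℕ} (A : Matrix (Fin m) (Fin n) S) (B : Matrix (Fin n) (Fin m) S) :
    Subalgebra R S :=
  Algebra.adjoin R ({s | ∃ i j, s = A i j} ∪ {s | ∃ i j, s = B j i})

theorem left_mem_entryAlgebra {n : ℕ} (A : Matrix (Fin m) (Fin n) S) (B : Matrix (Fin n) (Fin m) S)
    (i : Fin m) (j : Fin n) : A i j ∈ entryAlgebra R A B :=
  Algebra.subset_adjoin (.inl ⟨i, j, rfl⟩)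

theorem right_mem_entryAlgebra {n : ℕ} (A : Matrix (Fin m) (Fin n) S) (B : Matrix (Fin n) (Fin m) S)
    (j : Fin n) (i : Fin m) : B j i ∈ entryAlgebra R A B :=
  Algebra.subset_adjoin (.inr ⟨i, j, rfl⟩)

theorem entryAlgebra_le {n : ℕ} {A : Matrix (Fin m) (Fin n) S} {B : Matrix (Fin n) (Fin m) S}
    {V : Subalgebra R S} (hA : ∀ i j, A i j ∈ V) (hB : ∀ j i, B j i ∈ V) :
    entryAlgebra R A B ≤ V := by
  refine Algebra.adjoin_le ?_
  rintro _ (⟨i, j, rfl⟩ | ⟨i, j, rfl⟩)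
  exacts [hA i j, hB j i]

theorem entryAlgebra_map {n : ℕ} {S' : Type*} [CommRing S'] [Algebra R S'] (f : S →ₐ[R] S')
    (A : Matrix (Fin m) (Fin n) S) (B : Matrix (Fin n) (Fin m) S) :
    (entryAlgebra R A B).map f = entryAlgebra R (A.map f) (B.map f) := by
  refine le_antisymm ?_ (entryAlgebra_le (fun i j => ⟨_, left_mem_entryAlgebra A B i j, rfl⟩)
    fun j i => ⟨_, right_mem_entryAlgebra A B j i, rfl⟩)
  rw [Subalgebra.map_le]
  exact entryAlgebra_le (fun i j => left_mem_entryAlgebra (A.map f) (B.map f) i j)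
    fun j i => right_mem_entryAlgebra (A.map f) (B.map f) j i

theorem finiteType_of_entryAlgebra_eq_top {n : ℕ} {A : Matrix (Fin m) (Fin n) S}
    {B : Matrix (Fin n) (Fin m) S} (h : entryAlgebra R A B = ⊤) : Algebra.FiniteType R S := by
  refine ⟨Subalgebra.fg_def.mpr ⟨_, ?_, h⟩⟩
  refine Set.Finite.union ?_ ?_
  · refine (Set.finite_range fun p : Fin m × Fin n => A p.1 p.2).subset ?_
    rintro _ ⟨i, j, rfl⟩
    exact ⟨(i, j), rfl⟩
  · refine (Set.finite_range fun p : Fin m × Fin n => B p.2 p.1).subset ?_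
    rintro _ ⟨i, j, rfl⟩
    exact ⟨(i, j), rfl⟩

end Entries

section Solutions

/-- The matrix form of a finite projective difference module: the module is the image of the
idempotent matrix `P`, and `Φ`, `Ψ` describe `τ` and its inverse in terms of the images of the
standard basis vectors. -/
structure DifferenceSystem (R : Type*) [CommRing R] [DifferenceRing R] (m : ℕ) where
  /-- The idempotent matrix. -/
  P : Matrix (Fin m) (Fin m) R
  /-- The matrix of `τ`. -/
  Φ : Matrix (Fin m) (Fin m) R
  /-- The inverse of `Φ` relative to `P`. -/
  Ψ : Matrix (Fin m) (Fin m) R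
  P_mul_Φ : P * Φ = Φ
  Φ_mul_tau : Φ * P.map DifferenceRing.tau = Φ
  Ψ_mul_P : Ψ * P = Ψ
  Φ_mul_Ψ : Φ * Ψ = P
  Ψ_mul_Φ : Ψ * Φ = P.map DifferenceRing.tau

variable {R : Type*} [CommRing R] [DifferenceRing R] {m : ℕ} (D : DifferenceSystem R m)

variable {S : Type*} [CommRing S] [DifferenceRing S] [Algebra R S]

/-- A solution of a difference system in `S`: the columns of `A` are a `τ`-fixed basis of the image
of `P`, and the rows of `B` are the dual basis. -/
structure DifferenceSystem.IsSolution {n : ℕ} (A : Matrix (Fin m) (Fin n) S)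
    (B : Matrix (Fin n) (Fin m) S) : Prop where
  mul_eq_one : B * A = 1
  mul_eq_map : A * B = D.P.map (algebraMap R S)
  fixed : D.Φ.map (algebraMap R S) * A.map DifferenceRing.tau = A

namespace DifferenceSystem.IsSolution

variable {D} {n n' : ℕ} {A : Matrix (Fin m) (Fin n) S} {B : Matrix (Fin n) (Fin m) S}
  {A' : Matrix (Fin m) (Fin n') S} {B' : Matrix (Fin n') (Fin m) S}

theorem P_mul (h : D.IsSolution A B) : D.P.map (algebraMap R S) * A = A := by
  rw [← h.mul_eq_map, Matrix.mul_assoc, h.mul_eq_one, Matrix.mul_one]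

theorem mul_P (h : D.IsSolution A B) : B * D.P.map (algebraMap R S) = B := by
  rw [← h.mul_eq_map, ← Matrix.mul_assoc, h.mul_eq_one, Matrix.one_mul]

theorem tau_mul_tau_eq_one (h : D.IsSolution A B) :
    B.map DifferenceRing.tau * A.map DifferenceRing.tau = 1 := by
  rw [← Matrix.map_mul, h.mul_eq_one, Matrix.map_one _ (map_zero _) (map_one _)]

/-- The image of a solution under a morphism of difference algebras is a solution. -/
theorem map {S' : Type*} [CommRing S'] [DifferenceRing S'] [Algebra R S'] (f : S →ₐ[R] S')
    (hf : ∀ s, f (DifferenceRing.tau s) = DifferenceRing.tau (f s))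
    (h : D.IsSolution A B) : D.IsSolution (A.map f) (B.map f) where
  mul_eq_one := by
    rw [← Matrix.map_mul, h.mul_eq_one, Matrix.map_one _ (map_zero f) (map_one f)]
  mul_eq_map := by
    rw [← Matrix.map_mul, h.mul_eq_map, Matrix.map_map]
    congr 1; ext r; simp
  fixed := by
    have := congrArg (fun X => X.map f) h.fixed
    simp only [Matrix.map_mul, Matrix.map_map] at this
    rw [Matrix.map_map]
    convert this using 3
    · ext r; simp
    · ext s; simp [hf]

variable [DifferenceAlgebra R S]

theorem tau_algebraMap (r : R) : DifferenceRing.tau (algebraMap R S r) =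
    algebraMap R S (DifferenceRing.tau r) := (DifferenceAlgebra.algebraMap_tau r).symm

theorem tau_symm_algebraMap (r : R) : DifferenceRing.tau.symm (algebraMap R S r) =
    algebraMap R S (DifferenceRing.tau.symm r) := by
  rw [RingEquiv.symm_apply_eq, tau_algebraMap, RingEquiv.apply_symm_apply]

theorem tau_mul_tau (h : D.IsSolution A B) : A.map DifferenceRing.tau * B.map DifferenceRing.tau =
    (D.P.map DifferenceRing.tau).map (algebraMap R S) := by
  rw [← Matrix.map_mul, h.mul_eq_map, Matrix.map_algebraMap_map tau_algebraMap]

theorem tau_left (h : D.IsSolution A B) :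
    A.map DifferenceRing.tau = D.Ψ.map (algebraMap R S) * A := by
  conv_rhs => rw [← h.fixed]
  rw [← Matrix.mul_assoc, ← Matrix.map_mul, D.Ψ_mul_Φ, ← h.tau_mul_tau, Matrix.mul_assoc,
    h.tau_mul_tau_eq_one, Matrix.mul_one]

theorem fixed_right (h : D.IsSolution A B) :
    B.map DifferenceRing.tau * D.Ψ.map (algebraMap R S) = B := by
  rw [← D.Ψ_mul_P, Matrix.map_mul, ← h.mul_eq_map, ← Matrix.mul_assoc (D.Ψ.map _), ← h.tau_left,
    ← Matrix.mul_assoc, h.tau_mul_tau_eq_one, Matrix.one_mul]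

theorem tau_right (h : D.IsSolution A B) :
    B.map DifferenceRing.tau = B * D.Φ.map (algebraMap R S) := by
  conv_rhs => rw [← h.fixed_right]
  rw [Matrix.mul_assoc, ← Matrix.map_mul, D.Ψ_mul_Φ, ← h.tau_mul_tau, ← Matrix.mul_assoc,
    h.tau_mul_tau_eq_one, Matrix.one_mul]

theorem tau_symm_left (h : D.IsSolution A B) : A.map DifferenceRing.tau.symm =
    (D.Φ.map DifferenceRing.tau.symm).map (algebraMap R S) * A := by
  have := congrArg (fun X => X.map (DifferenceRing.tau : S ≃+* S).symm) h.fixed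
  simp only [Matrix.map_mul] at this
  rw [Matrix.map_algebraMap_map tau_symm_algebraMap] at this
  rw [← this]
  congr 1
  ext i j; simp

theorem tau_symm_right (h : D.IsSolution A B) : B.map DifferenceRing.tau.symm =
    B * (D.Ψ.map DifferenceRing.tau.symm).map (algebraMap R S) := by
  have := congrArg (fun X => X.map (DifferenceRing.tau : S ≃+* S).symm) h.fixed_right
  simp only [Matrix.map_mul] at this
  rw [Matrix.map_algebraMap_map tau_symm_algebraMap] at this
  rw [← this]
  congr 1
  ext i j; simp

/-- The entries of a solution are locally finite. -/
theorem entryAlgebra_le_locallyFinite (h : D.IsSolution A B) :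
    entryAlgebra R A B ≤ locallyFiniteSubalgebra R S := by
  have key : ∀ {k l : ℕ} (X : Matrix (Fin k) (Fin l) S),
      (∀ i j, DifferenceRing.tau (X i j) ∈
        Submodule.span R (Set.range fun p : Fin k × Fin l => X p.1 p.2)) →
      (∀ i j, DifferenceRing.tau.symm (X i j) ∈
        Submodule.span R (Set.range fun p : Fin k × Fin l => X p.1 p.2)) →
      ∀ i j, X i j ∈ locallyFiniteSubalgebra R S := by
    intro k l X h1 h2 i j
    refine ⟨_, Submodule.fg_span (Set.finite_range fun p : Fin k × Fin l => X p.1 p.2),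
      isTauStable_span ?_ ?_, Submodule.subset_span ⟨(i, j), rfl⟩⟩
    · rintro _ ⟨p, rfl⟩; exact h1 _ _
    · rintro _ ⟨p, rfl⟩; exact h2 _ _
  have hl : ∀ (Y : Matrix (Fin m) (Fin m) R) i j, (Y.map (algebraMap R S) * A) i j ∈
      Submodule.span R (Set.range fun p : Fin m × Fin n => A p.1 p.2) := by
    intro Y i j
    rw [Matrix.mul_apply]
    refine sum_mem fun k _ => ?_
    rw [Matrix.map_apply, ← Algebra.smul_def]
    exact Submodule.smul_mem _ _ (Submodule.subset_span ⟨(k, j), rfl⟩)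
  have hr : ∀ (Y : Matrix (Fin m) (Fin m) R) i j, (B * Y.map (algebraMap R S)) i j ∈
      Submodule.span R (Set.range fun p : Fin n × Fin m => B p.1 p.2) := by
    intro Y i j
    rw [Matrix.mul_apply]
    refine sum_mem fun k _ => ?_
    rw [Matrix.map_apply, mul_comm, ← Algebra.smul_def]
    exact Submodule.smul_mem _ _ (Submodule.subset_span ⟨(i, k), rfl⟩)
  refine entryAlgebra_le (key A (fun i j => ?_) fun i j => ?_)
    (key B (fun i j => ?_) fun i j => ?_)
  · have := congrFun (congrFun h.tau_left i) j
    rw [Matrix.map_apply] at this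
    exact this ▸ hl _ i j
  · have := congrFun (congrFun h.tau_symm_left i) j
    rw [Matrix.map_apply] at this
    exact this ▸ hl _ i j
  · have := congrFun (congrFun h.tau_right i) j
    rw [Matrix.map_apply] at this
    exact this ▸ hr _ i j
  · have := congrFun (congrFun h.tau_symm_right i) j
    rw [Matrix.map_apply] at this
    exact this ▸ hr _ i j

/-- Two solutions differ by a matrix of constants. -/
theorem mul_mem_differenceConstants (h : D.IsSolution A B) (h' : D.IsSolution A' B') (i : Fin n)
    (j : Fin n') : (B * A') i j ∈ differenceConstants S := by
  rw [mem_differenceConstants]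
  have : (B * A').map DifferenceRing.tau = B * A' := by
    rw [Matrix.map_mul, h'.tau_left, ← Matrix.mul_assoc, h.fixed_right]
  exact congrFun (congrFun this i) j

/-- If all constants come from `R`, the entries of any solution generate the same subalgebra. -/
theorem entryAlgebra_le_entryAlgebra (hconst : differenceConstants S ≤
    (differenceConstants R).map (algebraMap R S)) (h : D.IsSolution A B)
    (h' : D.IsSolution A' B') : entryAlgebra R A' B' ≤ entryAlgebra R A B := by
  have hc : ∀ {x : S}, x ∈ differenceConstants S → x ∈ entryAlgebra R A B := by
    intro x hx
    obtain ⟨r, -, rfl⟩ := hconst hx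
    exact Subalgebra.algebraMap_mem _ r
  refine entryAlgebra_le (fun i j => ?_) fun j i => ?_
  · have : A' = A * (B * A') := by
      rw [← Matrix.mul_assoc, h.mul_eq_map, h'.P_mul]
    rw [this, Matrix.mul_apply]
    exact sum_mem fun k _ => mul_mem (left_mem_entryAlgebra A B _ _)
      (hc (h.mul_mem_differenceConstants h' _ _))
  · have : B' = (B' * A) * B := by
      rw [Matrix.mul_assoc, h.mul_eq_map, h'.mul_P]
    rw [this, Matrix.mul_apply]
    exact sum_mem fun k _ => mul_mem (hc (h'.mul_mem_differenceConstants h _ _))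
      (right_mem_entryAlgebra A B _ _)

end DifferenceSystem.IsSolution

end Solutions

/-! ### The universal algebra of a difference system -/

section Universal

open MvPolynomial

/-- The generators of the universal algebra: the entries of an `m × n` and an `n × m` matrix. -/
abbrev EntryIndex (m n : ℕ) : Type := (Fin m × Fin n) ⊕ (Fin n × Fin m)

variable {R : Type u} [CommRing R] {m : ℕ}

section Frame

variable (P : Matrix (Fin m) (Fin m) R) (n : ℕ)

/-- The ideal of the relations `B A = 1`, `A B = P` between the generic matrices `A` and `B`. -/
noncomputable def frameIdeal : Ideal (MvPolynomial (EntryIndex m n) R) :=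
  Ideal.span
    ((Set.range fun p : Fin n × Fin n =>
      (∑ i, X (.inr (p.1, i)) * X (.inl (i, p.2)) - (1 : Matrix (Fin n) (Fin n) _) p.1 p.2)) ∪
    (Set.range fun p : Fin m × Fin m =>
      (∑ j, X (.inl (p.1, j)) * X (.inr (j, p.2)) - C (P p.1 p.2))))

/-- The universal `R`-algebra over which the image of the idempotent matrix `P` acquires a basis of
`n` elements. -/
def FrameAlgebra : Type u := MvPolynomial (EntryIndex m n) R ⧸ frameIdeal P n

namespace FrameAlgebra

noncomputable instance : CommRing (FrameAlgebra P n) :=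
  inferInstanceAs (CommRing (MvPolynomial (EntryIndex m n) R ⧸ frameIdeal P n))

noncomputable instance : Algebra R (FrameAlgebra P n) :=
  inferInstanceAs (Algebra R (MvPolynomial (EntryIndex m n) R ⧸ frameIdeal P n))

/-- The quotient map onto the frame algebra. -/
noncomputable def mk : MvPolynomial (EntryIndex m n) R →ₐ[R] FrameAlgebra P n :=
  Ideal.Quotient.mkₐ R (frameIdeal P n)

theorem mk_surjective : Function.Surjective (mk P n) := Ideal.Quotient.mk_surjective

theorem mk_eq_zero {x : MvPolynomial (EntryIndex m n) R} (hx : x ∈ frameIdeal P n) :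
    mk P n x = 0 :=
  Ideal.Quotient.eq_zero_iff_mem.mpr hx

/-- The universal basis, in coordinates. -/
noncomputable def left : Matrix (Fin m) (Fin n) (FrameAlgebra P n) :=
  Matrix.of fun i j => mk P n (X (.inl (i, j)))

/-- The dual of the universal basis, in coordinates. -/
noncomputable def right : Matrix (Fin n) (Fin m) (FrameAlgebra P n) :=
  Matrix.of fun j i => mk P n (X (.inr (j, i)))

theorem right_mul_left : right P n * left P n = 1 := by
  ext j j'
  have : (∑ i, X (.inr (j, i)) * X (.inl (i, j')) -
      (1 : Matrix (Fin n) (Fin n) (MvPolynomial (EntryIndex m n) R)) j j') ∈ frameIdeal P n :=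
    Ideal.subset_span (.inl ⟨(j, j'), rfl⟩)
  replace this := mk_eq_zero P n this
  rw [map_sub, sub_eq_zero, map_sum] at this
  simp only [Matrix.mul_apply, left, right, Matrix.of_apply, ← map_mul, this]
  rw [Matrix.one_apply, Matrix.one_apply]
  split_ifs <;> simp

theorem left_mul_right : left P n * right P n = P.map (algebraMap R (FrameAlgebra P n)) := by
  ext i i'
  have : (∑ j, X (.inl (i, j)) * X (.inr (j, i')) - C (P i i')) ∈ frameIdeal P n :=
    Ideal.subset_span (.inr ⟨(i, i'), rfl⟩)
  replace this := mk_eq_zero P n this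
  rw [map_sub, sub_eq_zero, map_sum] at this
  simp only [Matrix.mul_apply, left, right, Matrix.of_apply, ← map_mul, this]
  exact (mk P n).commutes _

variable {P n}
variable {T : Type*} [CommRing T]

/-- The universal property of the frame algebra. -/
noncomputable def lift (f : R →+* T) (A : Matrix (Fin m) (Fin n) T) (B : Matrix (Fin n) (Fin m) T)
    (hBA : B * A = 1) (hAB : A * B = P.map f) : FrameAlgebra P n →+* T :=
  Ideal.Quotient.lift (frameIdeal P n)
    (eval₂Hom f (Sum.elim (fun p => A p.1 p.2) fun p => B p.1 p.2)) <| by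
      intro a ha
      rw [← RingHom.mem_ker]
      refine (Ideal.span_le (I := RingHom.ker _)).mpr ?_ ha
      rintro _ (⟨⟨i, j⟩, rfl⟩ | ⟨⟨i, j⟩, rfl⟩)
      · have := congrFun (congrFun hBA i) j
        rw [Matrix.mul_apply] at this
        simp only [SetLike.mem_coe, RingHom.mem_ker, map_sub, map_sum, map_mul, coe_eval₂Hom,
          eval₂_X, Sum.elim_inr, Sum.elim_inl, this]
        rw [Matrix.one_apply, Matrix.one_apply]
        split_ifs <;> simp
      · have := congrFun (congrFun hAB i) j
        rw [Matrix.mul_apply] at this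
        simp [this]

variable {f : R →+* T} {A : Matrix (Fin m) (Fin n) T} {B : Matrix (Fin n) (Fin m) T}
    (hBA : B * A = 1) (hAB : A * B = P.map f)

@[simp]
theorem lift_algebraMap (r : R) : lift f A B hBA hAB (algebraMap R _ r) = f r := by
  change eval₂Hom f _ (C r) = f r
  simp

theorem lift_left : (left P n).map (lift f A B hBA hAB) = A := by
  ext i j
  change eval₂Hom f _ (X _) = _
  simp

theorem lift_right : (right P n).map (lift f A B hBA hAB) = B := by
  ext i j
  change eval₂Hom f _ (X _) = _
  simp

theorem hom_ext {g h : FrameAlgebra P n →+* T}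
    (h1 : ∀ r, g (algebraMap R _ r) = h (algebraMap R _ r))
    (h2 : (left P n).map g = (left P n).map h) (h3 : (right P n).map g = (right P n).map h) :
    g = h := by
  refine Ideal.Quotient.ringHom_ext (I := frameIdeal P n) (MvPolynomial.ringHom_ext h1 ?_)
  rintro (⟨i, j⟩ | ⟨i, j⟩)
  · exact congrFun (congrFun h2 i) j
  · exact congrFun (congrFun h3 i) j

theorem entryAlgebra_eq_top : entryAlgebra R (left P n) (right P n) = ⊤ := by
  rw [eq_top_iff]
  rintro x -
  obtain ⟨x, rfl⟩ := mk_surjective P n x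
  induction x using MvPolynomial.induction_on with
  | C r => exact (mk P n).commutes r ▸ Subalgebra.algebraMap_mem _ r
  | add p q hp hq => rw [map_add]; exact add_mem hp hq
  | mul_X p i hp =>
    rw [map_mul]
    refine mul_mem hp ?_
    rcases i with ⟨i, j⟩ | ⟨i, j⟩
    · exact left_mem_entryAlgebra (left P n) (right P n) i j
    · exact right_mem_entryAlgebra (left P n) (right P n) i j

end FrameAlgebra

end Frame

namespace DifferenceSystem

variable [DifferenceRing R] (D : DifferenceSystem R m) (n : ℕ)

open FrameAlgebra

/-- The action of `τ` on the frame algebra, `A ↦ Ψ A` and `B ↦ B Φ`. -/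
noncomputable def frameTau : FrameAlgebra D.P n →+* FrameAlgebra D.P n :=
  lift ((algebraMap R (FrameAlgebra D.P n)).comp (DifferenceRing.tau : R ≃+* R))
    (D.Ψ.map (algebraMap R (FrameAlgebra D.P n)) * left D.P n)
    (right D.P n * D.Φ.map (algebraMap R (FrameAlgebra D.P n))) (by
      rw [Matrix.mul_assoc, ← Matrix.mul_assoc (D.Φ.map _), ← Matrix.map_mul, D.Φ_mul_Ψ,
        ← left_mul_right, Matrix.mul_assoc, right_mul_left, Matrix.mul_one, right_mul_left]) (by
      rw [Matrix.mul_assoc, ← Matrix.mul_assoc (left D.P n), left_mul_right, ← Matrix.map_mul,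
        ← Matrix.map_mul, D.P_mul_Φ, D.Ψ_mul_Φ, Matrix.map_map]
      rfl)

/-- The action of the inverse of `τ` on the frame algebra. -/
noncomputable def frameTauInv : FrameAlgebra D.P n →+* FrameAlgebra D.P n :=
  lift ((algebraMap R (FrameAlgebra D.P n)).comp (DifferenceRing.tau.symm : R ≃+* R))
    ((D.Φ.map DifferenceRing.tau.symm).map (algebraMap R (FrameAlgebra D.P n)) * left D.P n)
    (right D.P n * (D.Ψ.map DifferenceRing.tau.symm).map (algebraMap R (FrameAlgebra D.P n))) (by
      have h : D.Ψ.map DifferenceRing.tau.symm * D.Φ.map DifferenceRing.tau.symm = D.P := by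
        rw [← Matrix.map_mul, D.Ψ_mul_Φ, Matrix.map_map]
        ext i j; simp
      rw [Matrix.mul_assoc, ← Matrix.mul_assoc (Matrix.map _ _), ← Matrix.map_mul, h,
        ← left_mul_right, Matrix.mul_assoc, right_mul_left, Matrix.mul_one, right_mul_left]) (by
      have h : D.Φ.map DifferenceRing.tau.symm * D.P = D.Φ.map DifferenceRing.tau.symm := by
        conv_rhs => rw [← D.Φ_mul_tau, Matrix.map_mul, Matrix.map_map]
        congr 1
        ext i j; simp
      rw [Matrix.mul_assoc, ← Matrix.mul_assoc (left D.P n), left_mul_right, ← Matrix.map_mul,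
        ← Matrix.map_mul, ← Matrix.mul_assoc, h, ← Matrix.map_mul, D.Φ_mul_Ψ, Matrix.map_map]
      rfl)

theorem frameTau_algebraMap (r : R) : D.frameTau n (algebraMap R (FrameAlgebra D.P n) r) =
    algebraMap R (FrameAlgebra D.P n) (DifferenceRing.tau r) := by
  rw [frameTau, lift_algebraMap]; rfl

theorem frameTauInv_algebraMap (r : R) : D.frameTauInv n (algebraMap R (FrameAlgebra D.P n) r) =
    algebraMap R (FrameAlgebra D.P n) (DifferenceRing.tau.symm r) := by
  rw [frameTauInv, lift_algebraMap]; rfl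

theorem map_algebraMap_map_frameTau (Y : Matrix (Fin m) (Fin m) R) :
    (Y.map (algebraMap R (FrameAlgebra D.P n))).map (D.frameTau n) =
      (Y.map DifferenceRing.tau).map (algebraMap R (FrameAlgebra D.P n)) := by
  ext i j; exact D.frameTau_algebraMap n _

theorem map_algebraMap_map_frameTauInv (Y : Matrix (Fin m) (Fin m) R) :
    (Y.map (algebraMap R (FrameAlgebra D.P n))).map (D.frameTauInv n) =
      (Y.map DifferenceRing.tau.symm).map (algebraMap R (FrameAlgebra D.P n)) := by
  ext i j; exact D.frameTauInv_algebraMap n _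

theorem P_mul_left : D.P.map (algebraMap R (FrameAlgebra D.P n)) * left D.P n = left D.P n := by
  rw [← left_mul_right, Matrix.mul_assoc, right_mul_left, Matrix.mul_one]

theorem right_mul_P : right D.P n * D.P.map (algebraMap R (FrameAlgebra D.P n)) = right D.P n := by
  rw [← left_mul_right, ← Matrix.mul_assoc, right_mul_left, Matrix.one_mul]

theorem frameTau_left : (left D.P n).map (D.frameTau n) =
    D.Ψ.map (algebraMap R (FrameAlgebra D.P n)) * left D.P n :=
  lift_left _ _

theorem frameTau_right : (right D.P n).map (D.frameTau n) =
    right D.P n * D.Φ.map (algebraMap R (FrameAlgebra D.P n)) :=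
  lift_right _ _

theorem frameTauInv_left : (left D.P n).map (D.frameTauInv n) =
    (D.Φ.map DifferenceRing.tau.symm).map (algebraMap R (FrameAlgebra D.P n)) * left D.P n :=
  lift_left _ _

theorem frameTauInv_right : (right D.P n).map (D.frameTauInv n) =
    right D.P n * (D.Ψ.map DifferenceRing.tau.symm).map (algebraMap R (FrameAlgebra D.P n)) :=
  lift_right _ _

theorem tau_symm_map_tau (Y : Matrix (Fin m) (Fin m) R) :
    (Y.map DifferenceRing.tau.symm).map DifferenceRing.tau = Y := by
  ext i j; simp

theorem tau_map_tau_symm (Y : Matrix (Fin m) (Fin m) R) :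
    (Y.map DifferenceRing.tau).map DifferenceRing.tau.symm = Y := by
  ext i j; simp

/-- The difference ring structure of the frame algebra. -/
@[reducible] noncomputable def frameDifferenceRing : DifferenceRing (FrameAlgebra D.P n) where
  tau := RingEquiv.ofRingHom (D.frameTau n) (D.frameTauInv n)
    (by
      refine hom_ext (fun r => ?_) ?_ ?_
      · simp [frameTau, frameTauInv]
      · rw [RingHom.coe_comp, ← Matrix.map_map, frameTauInv_left, Matrix.map_mul, frameTau_left,
          map_algebraMap_map_frameTau, tau_symm_map_tau, ← Matrix.mul_assoc, ← Matrix.map_mul,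
          D.Φ_mul_Ψ, P_mul_left]
        ext; rfl
      · rw [RingHom.coe_comp, ← Matrix.map_map, frameTauInv_right, Matrix.map_mul, frameTau_right,
          map_algebraMap_map_frameTau, tau_symm_map_tau, Matrix.mul_assoc, ← Matrix.map_mul,
          D.Φ_mul_Ψ, right_mul_P]
        ext; rfl)
    (by
      refine hom_ext (fun r => ?_) ?_ ?_
      · simp [frameTau, frameTauInv]
      · rw [RingHom.coe_comp, ← Matrix.map_map, frameTau_left, Matrix.map_mul, frameTauInv_left,
          map_algebraMap_map_frameTauInv, ← Matrix.mul_assoc, ← Matrix.map_mul, ← Matrix.map_mul,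
          D.Ψ_mul_Φ, tau_map_tau_symm, P_mul_left]
        ext; rfl
      · rw [RingHom.coe_comp, ← Matrix.map_map, frameTau_right, Matrix.map_mul, frameTauInv_right,
          map_algebraMap_map_frameTauInv, Matrix.mul_assoc, ← Matrix.map_mul, ← Matrix.map_mul,
          D.Ψ_mul_Φ, tau_map_tau_symm, right_mul_P]
        ext; rfl)

/-- A difference system has a solution generating a simple difference algebra, in every size in
which the image of its idempotent matrix has a basis over some nonzero algebra. -/
theorem exists_simple_solution {k : Type*} [CommRing k] [Nontrivial k] (f : R →+* k)
    (A₀ : Matrix (Fin m) (Fin n) k) (B₀ : Matrix (Fin n) (Fin m) k) (h1 : B₀ * A₀ = 1)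
    (h2 : A₀ * B₀ = D.P.map f) :
    ∃ (S : Type u) (_ : CommRing S) (_ : DifferenceRing S) (_ : Algebra R S)
      (_ : DifferenceAlgebra R S) (A : Matrix (Fin m) (Fin n) S) (B : Matrix (Fin n) (Fin m) S),
      IsSimpleDifferenceRing S ∧ D.IsSolution A B ∧ entryAlgebra R A B = ⊤ := by
  have : Nontrivial (FrameAlgebra D.P n) := (lift f A₀ B₀ h1 h2).domain_nontrivial
  let := D.frameDifferenceRing n
  have hτ : ∀ r : R, DifferenceRing.tau (algebraMap R (FrameAlgebra D.P n) r) =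
      algebraMap R (FrameAlgebra D.P n) (DifferenceRing.tau r) := D.frameTau_algebraMap n
  have hU : D.IsSolution (left D.P n) (right D.P n) := by
    refine ⟨right_mul_left _ _, left_mul_right _ _, ?_⟩
    change _ * (left D.P n).map (D.frameTau n) = _
    rw [frameTau_left, ← Matrix.mul_assoc, ← Matrix.map_mul, D.Φ_mul_Ψ, P_mul_left]
  obtain ⟨S, _, _, π, hπ, hπτ, hS⟩ := exists_simple_quotient (T := FrameAlgebra D.P n)
  let : Algebra R S := (π.comp (algebraMap R (FrameAlgebra D.P n))).toAlgebra
  let π' : FrameAlgebra D.P n →ₐ[R] S := { π with commutes' := fun r => rfl }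
  refine ⟨S, inferInstance, inferInstance, inferInstance, ⟨fun r => ?_⟩, (left D.P n).map π',
    (right D.P n).map π', hS, hU.map π' hπτ, ?_⟩
  · change π _ = DifferenceRing.tau (π _)
    rw [← hπτ, hτ]
  · rw [← entryAlgebra_map, entryAlgebra_eq_top, Algebra.map_top]
    exact (AlgHom.range_eq_top π').mpr hπ

end DifferenceSystem

end Universal

/-! ### Difference modules and difference systems -/

section Coordinates

variable {R : Type*} [CommRing R] {M : Type*} [AddCommGroup M] [Module R M]

theorem exists_dual_basis (R M : Type*) [CommRing R] [AddCommGroup M] [Module R M]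
    [Module.Finite R M] [Module.Projective R M] :
    ∃ (m : ℕ) (v : Fin m → M) (w : Fin m → Module.Dual R M), ∀ x, ∑ i, w i x • v i = x := by
  obtain ⟨m, f, hf⟩ := Module.Finite.exists_fin' R M
  obtain ⟨s, hs⟩ := Module.projective_lifting_property f LinearMap.id hf
  refine ⟨m, fun i => f (Pi.single i 1), fun i => (LinearMap.proj i).comp s, fun x => ?_⟩
  have h1 := LinearMap.congr_fun hs x
  simp only [LinearMap.comp_apply, LinearMap.id_apply] at h1
  conv_rhs => rw [← h1, ← Finset.univ_sum_single (s x)]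
  rw [map_sum]
  refine Finset.sum_congr rfl fun i _ => ?_
  rw [← map_smul, ← Pi.single_smul', smul_eq_mul, mul_one]
  rfl

variable (T : Type*) [CommRing T] [Algebra R T]

theorem Module.Dual.baseChange_tmul (φ : Module.Dual R M) (t : T) (x : M) :
    φ.baseChange T (t ⊗ₜ x) = t * algebraMap R T (φ x) := by
  simp [Module.Dual.baseChange_apply_tmul, Algebra.smul_def, mul_comm]

variable {m n : ℕ} {v : Fin m → M} {w : Fin m → Module.Dual R M}

variable (v w) in
/-- The matrix of a projector onto `M` attached to a dual basis. -/
def projectorMatrix : Matrix (Fin m) (Fin m) R := Matrix.of fun i l => w i (v l)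

variable {T}

theorem sum_baseChange_tmul (hvw : ∀ x, ∑ i, w i x • v i = x) (y : T ⊗[R] M) :
    ∑ i, (w i).baseChange T y ⊗ₜ[R] v i = y := by
  induction y with
  | zero => simp
  | add y z hy hz =>
    conv_rhs => rw [← hy, ← hz]
    simp [TensorProduct.add_tmul, Finset.sum_add_distrib]
  | tmul t x =>
    conv_rhs => rw [← hvw x, TensorProduct.tmul_sum]
    refine Finset.sum_congr rfl fun i _ => ?_
    rw [Module.Dual.baseChange_tmul, mul_comm, ← Algebra.smul_def, TensorProduct.smul_tmul]

variable (w) in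
/-- The coordinates of a family of vectors of `T ⊗ M`. -/
noncomputable def coordMatrix (e : Fin n → T ⊗[R] M) : Matrix (Fin m) (Fin n) T :=
  Matrix.of fun i j => (w i).baseChange T (e j)

variable (v) in
/-- The coordinates of the dual basis of a basis of `T ⊗ M`. -/
noncomputable def dualCoordMatrix (e : Module.Basis (Fin n) T (T ⊗[R] M)) :
    Matrix (Fin n) (Fin m) T :=
  Matrix.of fun j i => e.coord j (1 ⊗ₜ v i)

theorem dualCoordMatrix_mul (hvw : ∀ x, ∑ i, w i x • v i = x)
    (e : Module.Basis (Fin n) T (T ⊗[R] M)) : dualCoordMatrix v e * coordMatrix w e = 1 := by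
  ext j k
  have h1 := congrArg (e.coord j) (sum_baseChange_tmul hvw (e k))
  rw [map_sum] at h1
  rw [Matrix.mul_apply, Matrix.one_apply]
  have h2 : e.coord j (e k) = if j = k then 1 else 0 := by
    simp [Finsupp.single_apply, eq_comm]
  rw [← h2, ← h1]
  refine Finset.sum_congr rfl fun i _ => ?_
  have h3 : (w i).baseChange T (e k) ⊗ₜ[R] v i =
      (w i).baseChange T (e k) • ((1 : T) ⊗ₜ[R] v i) := by
    rw [TensorProduct.smul_tmul', smul_eq_mul, mul_one]
  rw [h3, map_smul, smul_eq_mul, mul_comm]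
  rfl

theorem mul_dualCoordMatrix (e : Module.Basis (Fin n) T (T ⊗[R] M)) :
    coordMatrix w e * dualCoordMatrix v e = (projectorMatrix v w).map (algebraMap R T) := by
  ext i l
  rw [Matrix.mul_apply]
  have h1 := congrArg ((w i).baseChange T) (e.sum_repr ((1 : T) ⊗ₜ[R] v l))
  rw [map_sum, Module.Dual.baseChange_tmul, one_mul] at h1
  rw [Matrix.map_apply, projectorMatrix, Matrix.of_apply, ← h1]
  refine Finset.sum_congr rfl fun j _ => ?_
  rw [map_smul, smul_eq_mul, mul_comm]
  rfl

/-- Matrices `A`, `B` with `B A = 1` and `A B = P` are the coordinates of a basis of `T ⊗ M`. -/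
noncomputable def basisOfMatrices (hvw : ∀ x, ∑ i, w i x • v i = x)
    {A : Matrix (Fin m) (Fin n) T} {B : Matrix (Fin n) (Fin m) T} (hBA : B * A = 1)
    (hAB : A * B = (projectorMatrix v w).map (algebraMap R T)) :
    Module.Basis (Fin n) T (T ⊗[R] M) :=
  .ofEquivFun <| .ofLinearMap
    (LinearMap.pi fun j => ∑ i, B j i • (w i).baseChange T)
    (Fintype.linearCombination T fun j => ∑ i, A i j ⊗ₜ[R] v i)
    (by
      refine LinearMap.pi_ext' fun k => LinearMap.ext_ring ?_
      have hBPA : B * (projectorMatrix v w).map (algebraMap R T) * A = 1 := by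
        rw [← hAB, ← Matrix.mul_assoc, hBA, Matrix.one_mul, hBA]
      ext j
      have := congrFun (congrFun hBPA j) k
      rw [Matrix.mul_assoc, Matrix.mul_apply] at this
      simp only [Matrix.mul_apply, Matrix.map_apply, projectorMatrix, Matrix.of_apply] at this
      simp only [LinearMap.comp_apply, LinearMap.coe_single, Fintype.linearCombination_apply_single,
        one_smul, LinearMap.pi_apply, LinearMap.sum_apply, LinearMap.smul_apply, map_sum,
        Module.Dual.baseChange_tmul, smul_eq_mul, LinearMap.id_apply]
      rw [Pi.single_apply, ← Matrix.one_apply (i := j) (j := k), ← this]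
      simp only [Finset.mul_sum]
      rw [Finset.sum_comm]
      exact Finset.sum_congr rfl fun i _ => Finset.sum_congr rfl fun l _ => by ring)
    (by
      ext x
      have h1 : ∀ i, ∑ j, B j i • (∑ l, A l j ⊗ₜ[R] v l) = (1 : T) ⊗ₜ[R] v i := by
        intro i
        conv_rhs => rw [← sum_baseChange_tmul hvw ((1 : T) ⊗ₜ[R] v i)]
        simp only [Finset.smul_sum]
        rw [Finset.sum_comm]
        refine Finset.sum_congr rfl fun l _ => ?_
        have := congrFun (congrFun hAB l) i
        simp only [Matrix.mul_apply, Matrix.map_apply, projectorMatrix, Matrix.of_apply] at this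
        rw [Module.Dual.baseChange_tmul, one_mul, ← this, TensorProduct.sum_tmul]
        refine Finset.sum_congr rfl fun j _ => ?_
        rw [TensorProduct.smul_tmul', smul_eq_mul, mul_comm]
      simp only [TensorProduct.AlgebraTensorModule.curry_apply, LinearMap.restrictScalars_comp,
        TensorProduct.curry_apply, LinearMap.comp_apply, LinearMap.coe_restrictScalars,
        Fintype.linearCombination_apply, LinearMap.pi_apply, LinearMap.sum_apply,
        LinearMap.smul_apply, Module.Dual.baseChange_tmul, one_mul, LinearMap.id_apply, smul_eq_mul,
        Finset.sum_smul]
      rw [Finset.sum_comm]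
      conv_rhs => rw [← hvw x, TensorProduct.tmul_sum]
      refine Finset.sum_congr rfl fun i _ => ?_
      rw [TensorProduct.tmul_smul, ← h1 i, Finset.smul_sum]
      refine Finset.sum_congr rfl fun j _ => ?_
      rw [mul_comm, mul_smul, algebraMap_smul])

theorem basisOfMatrices_apply (hvw : ∀ x, ∑ i, w i x • v i = x)
    {A : Matrix (Fin m) (Fin n) T} {B : Matrix (Fin n) (Fin m) T} (hBA : B * A = 1)
    (hAB : A * B = (projectorMatrix v w).map (algebraMap R T)) (j : Fin n) :
    basisOfMatrices hvw hBA hAB j = ∑ i, A i j ⊗ₜ[R] v i := by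
  simp [basisOfMatrices, Fintype.linearCombination_apply_single]

end Coordinates

section System

variable {R : Type*} [CommRing R] [DifferenceRing R] {M : Type*} [AddCommGroup M] [Module R M]
  [DifferenceModule R M] {m n : ℕ} {v : Fin m → M} {w : Fin m → Module.Dual R M}

open DifferenceModule in
/-- The difference system attached to a difference module with a dual basis. -/
def DifferenceSystem.ofModule (hvw : ∀ x, ∑ i, w i x • v i = x) : DifferenceSystem R m :=
  have hlin : ∀ (f : Module.Dual R M) x, ∑ k, f (v k) * w k x = f x := fun f x => by
    conv_rhs => rw [← hvw x]
    simp [mul_comm]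
  have hsemi : ∀ (f : Module.Dual R M) x,
      ∑ k, f (tau R (v k)) * DifferenceRing.tau (w k x) = f (tau R x) := fun f x => by
    conv_rhs => rw [← hvw x]
    simp [mul_comm, tau_smul]
  { P := projectorMatrix v w
    Φ := Matrix.of fun i l => w i (tau R (v l))
    Ψ := Matrix.of fun i l => DifferenceRing.tau (w i ((tau R).symm (v l)))
    P_mul_Φ := by
      ext i l; simpa [Matrix.mul_apply, projectorMatrix] using hlin _ _
    Φ_mul_tau := by
      ext i l; simpa [Matrix.mul_apply, projectorMatrix] using hsemi _ _
    Ψ_mul_P := by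
      ext i l
      simpa [Matrix.mul_apply, projectorMatrix, conjDual] using
        hlin (conjDual DifferenceRing.tau (tau R) tau_smul (w i)) (v l)
    Φ_mul_Ψ := by
      ext i l
      simpa [Matrix.mul_apply, projectorMatrix] using hsemi (w i) ((tau R).symm (v l))
    Ψ_mul_Φ := by
      ext i l
      simpa [Matrix.mul_apply, projectorMatrix, conjDual] using
        hlin (conjDual DifferenceRing.tau (tau R) tau_smul (w i)) (tau R (v l)) }

variable (hvw : ∀ x, ∑ i, w i x • v i = x) {S : Type*} [CommRing S] [DifferenceRing S]
  [Algebra R S]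

/-- The basis of `S ⊗ M` whose coordinates are a given solution. -/
noncomputable def DifferenceSystem.IsSolution.basis {A : Matrix (Fin m) (Fin n) S}
    {B : Matrix (Fin n) (Fin m) S} (h : (DifferenceSystem.ofModule hvw).IsSolution A B) :
    Module.Basis (Fin n) S (S ⊗[R] M) :=
  basisOfMatrices hvw h.mul_eq_one h.mul_eq_map

theorem DifferenceSystem.IsSolution.basis_apply {A : Matrix (Fin m) (Fin n) S}
    {B : Matrix (Fin n) (Fin m) S} (h : (DifferenceSystem.ofModule hvw).IsSolution A B)
    (j : Fin n) : h.basis hvw j = ∑ i, A i j ⊗ₜ[R] v i :=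
  basisOfMatrices_apply hvw h.mul_eq_one h.mul_eq_map j

variable [DifferenceAlgebra R S]

theorem isSolution_of_isFixedBasis (e : Module.Basis (Fin n) S (S ⊗[R] M)) (he : IsFixedBasis e) :
    (DifferenceSystem.ofModule hvw).IsSolution (coordMatrix w e) (dualCoordMatrix v e) where
  mul_eq_one := dualCoordMatrix_mul hvw e
  mul_eq_map := mul_dualCoordMatrix e
  fixed := by
    ext i j
    have h := congrArg (DifferenceModule.tau S) (sum_baseChange_tmul hvw (e j))
    rw [he j, map_sum] at h
    have h' := congrArg ((w i).baseChange S) h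
    simp only [map_sum, DifferenceModule.baseChange_tau_tmul, Module.Dual.baseChange_tmul] at h'
    rw [coordMatrix, Matrix.of_apply, ← h', Matrix.mul_apply]
    exact Finset.sum_congr rfl fun k _ => mul_comm _ _

theorem DifferenceSystem.IsSolution.isFixedBasis {A : Matrix (Fin m) (Fin n) S}
    {B : Matrix (Fin n) (Fin m) S} (h : (DifferenceSystem.ofModule hvw).IsSolution A B) :
    IsFixedBasis (h.basis hvw) := by
  intro j
  rw [h.basis_apply, map_sum]
  conv_rhs => rw [← h.fixed]
  simp only [Matrix.mul_apply, TensorProduct.sum_tmul]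
  rw [Finset.sum_comm]
  refine Finset.sum_congr rfl fun k _ => ?_
  rw [DifferenceModule.baseChange_tau_tmul]
  conv_lhs => rw [← hvw (DifferenceModule.tau R (v k)), TensorProduct.tmul_sum]
  refine Finset.sum_congr rfl fun i _ => ?_
  rw [← TensorProduct.smul_tmul, Algebra.smul_def]
  rfl

/-- A simple difference algebra generated by a solution is a Picard-Vessiot extension. -/
theorem DifferenceSystem.IsSolution.isPicardVessiot (hR : IsSimpleDifferenceRing R)
    (hC : HasAlgClosedConstants R) (hS : IsSimpleDifferenceRing S)
    {A : Matrix (Fin m) (Fin n) S} {B : Matrix (Fin n) (Fin m) S}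
    (h : (DifferenceSystem.ofModule hvw).IsSolution A B) (hgen : entryAlgebra R A B = ⊤) :
    IsPicardVessiot R M S := by
  have := hS.nontrivial
  have hlf : locallyFiniteSubalgebra R S = ⊤ :=
    eq_top_iff.mpr (hgen ▸ h.entryAlgebra_le_locallyFinite)
  have hconst := differenceConstants_eq_map hR hC hS (finiteType_of_entryAlgebra_eq_top hgen) hlf
  refine ⟨faithfullyFlat_of_locallyFinite hR hlf, hS, hconst, ⟨n, _, h.isFixedBasis hvw⟩, ?_⟩
  intro m' n' v' w' e A' B' _ _ he hA' hB'
  have h' := isSolution_of_isFixedBasis hvw e he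
  refine eq_top_iff.mpr ((hgen.symm.le.trans
    (h'.entryAlgebra_le_entryAlgebra hconst.le h)).trans (entryAlgebra_le (fun i j => ?_)
      fun j i => ?_))
  · rw [coordMatrix, Matrix.of_apply, hA', map_sum]
    refine sum_mem fun k _ => ?_
    rw [Module.Dual.baseChange_tmul]
    exact mul_mem (Algebra.subset_adjoin (.inl ⟨k, j, rfl⟩)) (Subalgebra.algebraMap_mem _ _)
  · rw [dualCoordMatrix, Matrix.of_apply, hB']
    refine sum_mem fun k _ => ?_
    exact mul_mem (Algebra.subset_adjoin (.inr ⟨k, j, rfl⟩)) (Subalgebra.algebraMap_mem _ _)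

/-- A Picard-Vessiot extension is generated by a solution. -/
theorem IsPicardVessiot.exists_isSolution (h : IsPicardVessiot R M S) :
    ∃ (n : ℕ) (A : Matrix (Fin m) (Fin n) S) (B : Matrix (Fin n) (Fin m) S),
      (DifferenceSystem.ofModule hvw).IsSolution A B ∧ entryAlgebra R A B = ⊤ := by
  obtain ⟨n, e, he⟩ := h.trivial
  refine ⟨n, _, _, isSolution_of_isFixedBasis hvw e he,
    h.generated m n v w e (coordMatrix w e) (fun i j => dualCoordMatrix v e j i) ?_ ?_ he ?_ ?_⟩
  · refine eq_top_iff.mpr fun x _ => ?_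
    rw [← hvw x]
    exact sum_mem fun i _ => Submodule.smul_mem _ _ (Submodule.subset_span ⟨i, rfl⟩)
  · refine eq_top_iff.mpr fun φ _ => ?_
    have : φ = ∑ i, φ (v i) • w i := by
      ext x
      conv_lhs => rw [← hvw x]
      simp [mul_comm]
    rw [this]
    exact sum_mem fun i _ => Submodule.smul_mem _ _ (Submodule.subset_span ⟨i, rfl⟩)
  · exact fun j => (sum_baseChange_tmul hvw (e j)).symm
  · intro j x
    conv_lhs => rw [← hvw x, TensorProduct.tmul_sum, map_sum]
    refine Finset.sum_congr rfl fun i _ => ?_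
    rw [TensorProduct.tmul_smul, ← algebraMap_smul S (w i x), map_smul, smul_eq_mul, mul_comm]
    rfl

end System

/-! ### Uniqueness and ind-noetherianity -/

section Uniqueness

variable {R : Type*} [CommRing R] [DifferenceRing R] {m : ℕ} {D : DifferenceSystem R m}

/-- Two simple difference algebras generated by solutions of the same system are isomorphic: both
embed into a simple quotient of their tensor product, and have the same image there because that
quotient has no new constants. -/
theorem DifferenceSystem.IsSolution.exists_algEquiv {S S' : Type*} [CommRing S] [DifferenceRing S]
    [Algebra R S] [DifferenceAlgebra R S] [CommRing S'] [DifferenceRing S'] [Algebra R S']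
    [DifferenceAlgebra R S'] (hR : IsSimpleDifferenceRing R) (hC : HasAlgClosedConstants R)
    (hS : IsSimpleDifferenceRing S) (hS' : IsSimpleDifferenceRing S') {n n' : ℕ}
    {A : Matrix (Fin m) (Fin n) S} {B : Matrix (Fin n) (Fin m) S}
    {A' : Matrix (Fin m) (Fin n') S'} {B' : Matrix (Fin n') (Fin m) S'}
    (h : D.IsSolution A B) (h' : D.IsSolution A' B') (hgen : entryAlgebra R A B = ⊤)
    (hgen' : entryAlgebra R A' B' = ⊤) :
    ∃ f : S ≃ₐ[R] S', ∀ s : S, f (DifferenceRing.tau s) = DifferenceRing.tau (f s) := by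
  have := hS.nontrivial
  have := hS'.nontrivial
  have hlf : locallyFiniteSubalgebra R S = ⊤ :=
    eq_top_iff.mpr (hgen ▸ h.entryAlgebra_le_locallyFinite)
  have hlf' : locallyFiniteSubalgebra R S' = ⊤ :=
    eq_top_iff.mpr (hgen' ▸ h'.entryAlgebra_le_locallyFinite)
  have := faithfullyFlat_of_locallyFinite hR hlf'
  have : Nontrivial (S ⊗[R] S') := inferInstance
  let := DifferenceRing.tensorProduct R S S'
  obtain ⟨Q, _, _, π, hπ, hπτ, hQ⟩ := exists_simple_quotient (T := S ⊗[R] S')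
  have := hQ.nontrivial
  let : Algebra R Q := (π.comp (algebraMap R _)).toAlgebra
  let π' : S ⊗[R] S' →ₐ[R] Q := { π with commutes' := fun r => rfl }
  let i : S →ₐ[R] Q := π'.comp Algebra.TensorProduct.includeLeft
  let i' : S' →ₐ[R] Q := π'.comp Algebra.TensorProduct.includeRight
  have hi : ∀ s, i (DifferenceRing.tau s) = DifferenceRing.tau (i s) := by
    intro s
    change π (DifferenceRing.tau s ⊗ₜ 1) = DifferenceRing.tau (π (s ⊗ₜ 1))
    rw [← hπτ]
    congr 1
    change _ = DifferenceRing.tau s ⊗ₜ[R] DifferenceRing.tau (1 : S')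
    rw [map_one]
  have hi' : ∀ s, i' (DifferenceRing.tau s) = DifferenceRing.tau (i' s) := by
    intro s
    change π (1 ⊗ₜ DifferenceRing.tau s) = DifferenceRing.tau (π (1 ⊗ₜ s))
    rw [← hπτ]
    congr 1
    change _ = DifferenceRing.tau (1 : S) ⊗ₜ[R] DifferenceRing.tau s
    rw [map_one]
  have : DifferenceAlgebra R Q := ⟨fun r => by
    rw [← i.commutes, ← i.commutes, DifferenceAlgebra.algebraMap_tau, hi]⟩
  have hiA := h.map i hi
  have hiA' := h'.map i' hi'
  have hrange : i.range = entryAlgebra R (A.map i) (B.map i) := by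
    rw [← entryAlgebra_map, hgen, Algebra.map_top]
  have hrange' : i'.range = entryAlgebra R (A'.map i') (B'.map i') := by
    rw [← entryAlgebra_map, hgen', Algebra.map_top]
  have hfin : Algebra.FiniteType R Q := by
    have h1 := finiteType_of_entryAlgebra_eq_top hgen
    have h2 := finiteType_of_entryAlgebra_eq_top hgen'
    have h3 : Algebra.FiniteType R (S ⊗[R] S') := Algebra.FiniteType.trans h1 inferInstance
    exact h3.of_surjective π' hπ
  have hlfQ : locallyFiniteSubalgebra R Q = ⊤ := by
    refine eq_top_iff.mpr ?_
    rintro x -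
    obtain ⟨x, rfl⟩ := hπ x
    induction x with
    | zero => rw [map_zero]; exact zero_mem _
    | add x y hx hy => rw [map_add]; exact add_mem hx hy
    | tmul s s' =>
      have hmul : π (s ⊗ₜ s') = i s * i' s' := by
        change _ = π (s ⊗ₜ 1) * π (1 ⊗ₜ s')
        rw [← map_mul, Algebra.TensorProduct.tmul_mul_tmul, mul_one, one_mul]
      rw [hmul]
      exact mul_mem
        (hiA.entryAlgebra_le_locallyFinite (hrange ▸ (⟨s, rfl⟩ : i s ∈ i.range)))
        (hiA'.entryAlgebra_le_locallyFinite (hrange' ▸ (⟨s', rfl⟩ : i' s' ∈ i'.range)))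
  have hconst := (differenceConstants_eq_map hR hC hQ hfin hlfQ).le
  have heq : i.range = i'.range := by
    rw [hrange, hrange']
    exact le_antisymm (hiA'.entryAlgebra_le_entryAlgebra hconst hiA)
      (hiA.entryAlgebra_le_entryAlgebra hconst hiA')
  have hinj : Function.Injective i := hS.injective (i : S →+* Q) hi
  have hinj' : Function.Injective i' := hS'.injective (i' : S' →+* Q) hi'
  let f : S ≃ₐ[R] S' := ((AlgEquiv.ofInjective i hinj).trans (Subalgebra.equivOfEq _ _ heq)).trans
    (AlgEquiv.ofInjective i' hinj').symm
  have hf : ∀ s, i' (f s) = i s := fun s =>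
    congrArg Subtype.val ((AlgEquiv.ofInjective i' hinj').apply_symm_apply
      (Subalgebra.equivOfEq _ _ heq (AlgEquiv.ofInjective i hinj s)))
  exact ⟨f, fun s => hinj' (by rw [hf, hi, ← hf, hi'])⟩

end Uniqueness

section IndNoetherian

variable {R : Type*} [CommRing R]

theorem DirectedOn.exists_finset_subset {F : Set (Subring R)} (hne : F.Nonempty)
    (hdir : DirectedOn (· ≤ ·) F) (hF : ∀ r : R, ∃ A ∈ F, r ∈ A) (s : Finset R) :
    ∃ A ∈ F, ∀ r ∈ s, r ∈ A := by
  classical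
  induction s using Finset.induction_on with
  | empty => exact ⟨_, hne.some_mem, by simp⟩
  | insert a s _ ih =>
    obtain ⟨A, hA, hs⟩ := ih
    obtain ⟨A', hA', ha⟩ := hF a
    obtain ⟨A'', hA'', h1, h2⟩ := hdir A hA A' hA'
    refine ⟨A'', hA'', fun r hr => ?_⟩
    rcases Finset.mem_insert.mp hr with rfl | hr
    exacts [h2 ha, h1 (hs r hr)]

variable {S : Type*} [CommRing S] [Algebra R S]

theorem isNoetherianRing_closure {A₀ : Subring R} [IsNoetherianRing A₀] {G : Set S}
    (hG : G.Finite) : IsNoetherianRing (Subring.closure (algebraMap R S '' A₀ ∪ G)) := by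
  have h1 : (Algebra.adjoin A₀ G).toSubring = Subring.closure (algebraMap R S '' A₀ ∪ G) := by
    rw [Algebra.adjoin_eq_ring_closure]
    congr 2
    ext x
    constructor
    · rintro ⟨a, rfl⟩; exact ⟨a, a.2, rfl⟩
    · rintro ⟨a, ha, rfl⟩; exact ⟨⟨a, ha⟩, rfl⟩
  have h2 : IsNoetherianRing (Algebra.adjoin A₀ G) :=
    isNoetherianRing_of_fg (Subalgebra.fg_def.mpr ⟨G, hG, rfl⟩)
  rw [← h1]
  exact h2

variable [DifferenceRing S]

theorem isDifferenceSubring_closure {G : Set S}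
    (h : ∀ g ∈ G, DifferenceRing.tau g ∈ Subring.closure G)
    (h' : ∀ g ∈ G, DifferenceRing.tau.symm g ∈ Subring.closure G) :
    IsDifferenceSubring (Subring.closure G) := by
  have h1 : Subring.closure G ≤
      (Subring.closure G).comap ((DifferenceRing.tau : S ≃+* S) : S →+* S) :=
    Subring.closure_le.mpr h
  have h2 : Subring.closure G ≤
      (Subring.closure G).comap ((DifferenceRing.tau.symm : S ≃+* S) : S →+* S) :=
    Subring.closure_le.mpr h'
  refine fun s => ⟨fun hs => ?_, fun hs => h1 hs⟩
  simpa using h2 hs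

variable [DifferenceRing R] [DifferenceAlgebra R S]

/-- A difference algebra generated by a solution over an ind-noetherian difference ring is
ind-noetherian: adjoin the solution to the noetherian difference subrings of the base that contain
the coefficients of the system. -/
theorem DifferenceSystem.IsSolution.isIndNoetherian {m n : ℕ} {D : DifferenceSystem R m}
    {A : Matrix (Fin m) (Fin n) S} {B : Matrix (Fin n) (Fin m) S} (h : D.IsSolution A B)
    (hgen : entryAlgebra R A B = ⊤) (hR : IsIndNoetherian R) : IsIndNoetherian S := by
  classical
  obtain ⟨F, hne, hdir, hF, hcover⟩ := hR
  let G : Set S := {s | ∃ i j, s = A i j} ∪ {s | ∃ i j, s = B j i}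
  have hGfin : G.Finite := by
    refine Set.Finite.union ?_ ?_
    · refine (Set.finite_range fun p : Fin m × Fin n => A p.1 p.2).subset ?_
      rintro _ ⟨i, j, rfl⟩
      exact ⟨(i, j), rfl⟩
    · refine (Set.finite_range fun p : Fin m × Fin n => B p.2 p.1).subset ?_
      rintro _ ⟨i, j, rfl⟩
      exact ⟨(i, j), rfl⟩
  let V : Subring R → Subring S := fun A₀ => Subring.closure (algebraMap R S '' A₀ ∪ G)
  have hVmono : Monotone V := fun A₀ A₁ hle =>
    Subring.closure_mono (Set.union_subset_union_left _ (Set.image_mono hle))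
  let F' : Set (Subring R) := {A₀ ∈ F | ∀ i l, D.Φ i l ∈ A₀ ∧ D.Ψ i l ∈ A₀}
  have hdir' : DirectedOn (· ≤ ·) F' := by
    rintro A₀ ⟨hA₀, h0⟩ A₁ ⟨hA₁, -⟩
    obtain ⟨A₂, hA₂, h02, h12⟩ := hdir A₀ hA₀ A₁ hA₁
    exact ⟨A₂, ⟨hA₂, fun i l => ⟨h02 (h0 i l).1, h02 (h0 i l).2⟩⟩, h02, h12⟩
  have hcover' : ∀ r : R, ∃ A₀ ∈ F', r ∈ A₀ := by
    intro r
    obtain ⟨A₀, hA₀, hs⟩ := hdir.exists_finset_subset hne hcover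
      ({r} ∪ (Finset.univ.image fun p : Fin m × Fin m => D.Φ p.1 p.2) ∪
        Finset.univ.image fun p : Fin m × Fin m => D.Ψ p.1 p.2)
    refine ⟨A₀, ⟨hA₀, fun i l => ⟨hs _ ?_, hs _ ?_⟩⟩, hs r (by simp)⟩
    · exact Finset.mem_union_left _ (Finset.mem_union_right _
        (Finset.mem_image.mpr ⟨(i, l), Finset.mem_univ _, rfl⟩))
    · exact Finset.mem_union_right _ (Finset.mem_image.mpr ⟨(i, l), Finset.mem_univ _, rfl⟩)
  refine ⟨V '' F', ?_, ?_, ?_, fun s => ?_⟩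
  · obtain ⟨A₀, hA₀, -⟩ := hcover' 0
    exact ⟨_, A₀, hA₀, rfl⟩
  · rintro _ ⟨A₀, hA₀, rfl⟩ _ ⟨A₁, hA₁, rfl⟩
    obtain ⟨A₂, hA₂, h02, h12⟩ := hdir' A₀ hA₀ A₁ hA₁
    exact ⟨_, ⟨A₂, hA₂, rfl⟩, hVmono h02, hVmono h12⟩
  · rintro _ ⟨A₀, ⟨hA₀, hD⟩, rfl⟩
    obtain ⟨hτ, hnoeth⟩ := hF A₀ hA₀
    refine ⟨?_, isNoetherianRing_closure hGfin⟩
    have hτ' : ∀ r ∈ A₀, DifferenceRing.tau.symm r ∈ A₀ := fun r hr =>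
      (hτ _).mp (by simpa using hr)
    have hbase : ∀ r ∈ A₀, algebraMap R S r ∈ V A₀ := fun r hr =>
      Subring.subset_closure (.inl ⟨r, hr, rfl⟩)
    have hl : ∀ (Y : Matrix (Fin m) (Fin m) R), (∀ i l, Y i l ∈ A₀) → ∀ i j,
        (Y.map (algebraMap R S) * A) i j ∈ V A₀ := fun Y hY i j => by
      rw [Matrix.mul_apply]
      exact sum_mem fun k _ => mul_mem (hbase _ (hY i k))
        (Subring.subset_closure (.inr (.inl ⟨k, j, rfl⟩)))
    have hr : ∀ (Y : Matrix (Fin m) (Fin m) R), (∀ i l, Y i l ∈ A₀) → ∀ j i,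
        (B * Y.map (algebraMap R S)) j i ∈ V A₀ := fun Y hY j i => by
      rw [Matrix.mul_apply]
      exact sum_mem fun k _ => mul_mem
        (Subring.subset_closure (.inr (.inr ⟨k, j, rfl⟩))) (hbase _ (hY k i))
    refine isDifferenceSubring_closure ?_ ?_
    · rintro _ (⟨r, hr', rfl⟩ | ⟨i, j, rfl⟩ | ⟨i, j, rfl⟩)
      · rw [← DifferenceAlgebra.algebraMap_tau]
        exact hbase _ ((hτ r).mpr hr')
      · have := congrFun (congrFun h.tau_left i) j
        rw [Matrix.map_apply] at this
        exact this ▸ hl _ (fun i l => (hD i l).2) i j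
      · have := congrFun (congrFun h.tau_right j) i
        rw [Matrix.map_apply] at this
        exact this ▸ hr _ (fun i l => (hD i l).1) j i
    · rintro _ (⟨r, hr', rfl⟩ | ⟨i, j, rfl⟩ | ⟨i, j, rfl⟩)
      · rw [DifferenceSystem.IsSolution.tau_symm_algebraMap]
        exact hbase _ (hτ' r hr')
      · have := congrFun (congrFun h.tau_symm_left i) j
        rw [Matrix.map_apply] at this
        exact this ▸ hl _ (fun i l => hτ' _ (hD i l).1) i j
      · have := congrFun (congrFun h.tau_symm_right j) i
        rw [Matrix.map_apply] at this
        exact this ▸ hr _ (fun i l => hτ' _ (hD i l).2) j i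
  · suffices ∃ A₀ ∈ F', s ∈ V A₀ by
      obtain ⟨A₀, hA₀, hs⟩ := this
      exact ⟨V A₀, ⟨A₀, hA₀, rfl⟩, hs⟩
    have hjoin : ∀ {x y : S}, (∃ A₀ ∈ F', x ∈ V A₀) → (∃ A₀ ∈ F', y ∈ V A₀) →
        ∃ A₀ ∈ F', x ∈ V A₀ ∧ y ∈ V A₀ := by
      rintro x y ⟨A₀, hA₀, hx⟩ ⟨A₁, hA₁, hy⟩
      obtain ⟨A₂, hA₂, h02, h12⟩ := hdir' A₀ hA₀ A₁ hA₁
      exact ⟨A₂, hA₂, hVmono h02 hx, hVmono h12 hy⟩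
    have hs : s ∈ Algebra.adjoin R G := by
      change s ∈ entryAlgebra R A B
      rw [hgen]; exact Algebra.mem_top
    induction hs using Algebra.adjoin_induction with
    | mem x hx =>
      obtain ⟨A₀, hA₀, -⟩ := hcover' 0
      exact ⟨A₀, hA₀, Subring.subset_closure (.inr hx)⟩
    | algebraMap r =>
      obtain ⟨A₀, hA₀, hr⟩ := hcover' r
      exact ⟨A₀, hA₀, Subring.subset_closure (.inl ⟨r, hr, rfl⟩)⟩
    | add x y _ _ hx hy =>
      obtain ⟨A₀, hA₀, h1, h2⟩ := hjoin hx hy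
      exact ⟨A₀, hA₀, add_mem h1 h2⟩
    | mul x y _ _ hx hy =>
      obtain ⟨A₀, hA₀, h1, h2⟩ := hjoin hx hy
      exact ⟨A₀, hA₀, mul_mem h1 h2⟩

end IndNoetherian

/-! ### Picard-Vessiot extensions -/

theorem mainTheorem1 (R : Type u) [CommRing R] [DifferenceRing R]
    (hsimple : IsSimpleDifferenceRing R) (hind : IsIndNoetherian R)
    (hconst : HasAlgClosedConstants R)
    (M : Type v) [AddCommGroup M] [Module R M] [DifferenceModule R M]
    [Module.Finite R M] [Module.Projective R M] :
    ∃ (S : Type u) (_ : CommRing S) (_ : DifferenceRing S) (_ : Algebra R S)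
      (_ : DifferenceAlgebra R S),
      IsPicardVessiot R M S ∧ IsIndNoetherian S ∧
      ∀ (S' : Type w) [CommRing S'] [DifferenceRing S'] [Algebra R S'] [DifferenceAlgebra R S'],
        IsPicardVessiot R M S' →
          ∃ f : S ≃ₐ[R] S', ∀ s : S, f (DifferenceRing.tau s) = DifferenceRing.tau (f s) := by
  have := hsimple.nontrivial
  obtain ⟨m, v, w, hvw⟩ := exists_dual_basis R M
  -- The fibre of `M` at a maximal ideal has a basis, so the frame algebra of its rank is nonzero.
  obtain ⟨I, hI⟩ := Ideal.exists_maximal R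
  let := Ideal.Quotient.field I
  let e := Module.finBasis (R ⧸ I) ((R ⧸ I) ⊗[R] M)
  obtain ⟨S, _, _, _, _, A, B, hS, hAB, hgen⟩ :=
    (DifferenceSystem.ofModule hvw).exists_simple_solution _ (algebraMap R (R ⧸ I))
      (coordMatrix w e) (dualCoordMatrix v e) (dualCoordMatrix_mul hvw e) (mul_dualCoordMatrix e)
  refine ⟨S, inferInstance, inferInstance, inferInstance, inferInstance,
    hAB.isPicardVessiot hvw hsimple hconst hS hgen, hAB.isIndNoetherian hgen hind, ?_⟩
  intro S' _ _ _ _ hS'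
  obtain ⟨n', A', B', hAB', hgen'⟩ := hS'.exists_isSolution hvw
  exact hAB.exists_algEquiv hsimple hconst hS hS'.simple hAB' hgen hgen'
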